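/- Let $d\ge 0$, $n\ge 1$, $m\ge 0$ be integers. A \emph{record} is a pair $(x,y)$ with $x\in\mathbb R^d$, $\|x\|_2\le 1$, $y\in\{-1,1\}$, and a \emph{database} is an $n$-tuple $D=((x_i,y_i))_{i=1}^n$ of records; two databases are \emph{neighbors} if they differ in the value of at most one record. A randomized mechanism $\mathcal M$ (a probability law $\mathcal M(D)$ for each $D$) is \emph{$\epsilon$-differentially private} if $\mathcal M(D)(V)\le e^{\epsilon}\mathcal M(D')(V)$ for all neighbors $D,D'$ and all measurable $V$, and satisfies \emph{$\rho$-zCDP} if the Rényi divergences satisfy $D_a(\mathcal M(D)\|\mathcal M(D'))\le\rho a$ for all neighbors $D,D'$ and all $a\in(1,\infty)$. Let $f:\mathbb R\to\mathbb R$ be convex and twice differentiable with $|f'|\le 1$ and $|f''|\le t$, and put $f(x,y,\theta)=f(y\,\theta^{T}x)$. Let $\phi_1,\phi_2,\phi_3>0$ and $c>\frac{t}{2n(e^{\phi_1}-1)}$, and set $\epsilon'=\phi_1-\log\bigl(1+\frac{t}{2nc}\bigr)>0$. For $\gamma>0$ let $\mathrm{Lap}_k(\gamma)$ be the probability law on $\mathbb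 R^k$ with density proportional to $e^{-\gamma\|b\|_2}$. For $\theta\in\mathbb R^d$ let $$H_D(\theta)=\frac1n\sum_{i=1}^n \nabla^2_\theta f(x_i,y_i,\theta)+2c\,I,\qquad \Sigma_D(\theta)=\frac1n\sum_{i=1}^n\nabla_\theta f(x_i,y_i,\theta)\,[\nabla_\theta f(x_i,y_i,\theta)]^{T}-4c^2\theta\theta^{T},$$ and let $s_H(\theta)$, $s_\Sigma(\theta)$ be (measurable, nonnegative) upper bounds for the $L_2$-sensitivities at $\theta$, i.e. for the suprema over neighbors $D,D'$ of the Frobenius norms $\|H_D(\theta)-H_{D'}(\theta)\|$ and $\|\Sigma_D(\theta)-\Sigma_{D'}(\theta)\|$; for example the sensitivities themselves. The subroutine $\mathrm{PrivSPDMat}(M,s,\phi)$ has two modes. It draws $\eta\in\mathbb R^{d^2}$, in the \emph{differential privacy mode} from $\mathrm{Lap}_{d^2}(\phi/s)$, and in the \emph{zCDP mode} from $N\bigl(0,\frac{s^2}{2\phi}I\bigr)$ (with $\eta=0$ if $s=0$), reshapes $\eta$ to a $d\times d$ matrix $E$, forms $\tilde M=\frac12\bigl((M+E)+(M+E)^{T}\bigr)$,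 and returns $\tilde M$ with each eigenvalue $\lambda$ replaced by $\max(\lambda,2c)$ in an orthonormal eigen-decomposition. Consider the following algorithm on input $D$. 1. (Objective perturbation) Draw $\beta\sim\mathrm{Lap}_d(\epsilon'/2)$ and let $\tilde\theta=\arg\min_\theta\Bigl(\frac1n\sum_{i=1}^n\bigl[f(x_i,y_i,\theta)+c\|\theta\|_2^2\bigr]+\frac1n\beta^{T}\theta\Bigr)$. 2. Draw independently $\tilde H=\mathrm{PrivSPDMat}(H_D(\tilde\theta),s_H(\tilde\theta),\phi_2)$ and $\tilde\Sigma=\mathrm{PrivSPDMat}(\Sigma_D(\tilde\theta),s_\Sigma(\tilde\theta),\phi_3)$. 3. Draw independent $G_1,\dots,G_m\sim N(0,\tilde\Sigma)$ and $\beta_1,\dots,\beta_m\sim\mathrm{Lap}_d(\epsilon'/2)$, and let $\theta^{(i)}=\tilde\theta+\tilde H^{-1}\bigl(G_i+\tfrac1{\sqrt n}\beta_i\bigr)/\sqrt n$. 4. For each coordinate $j$ let $[\theta_L[j],\theta_R[j]]$ be a $(1-\alpha)$-confidence interval for $\theta^{(1)}[j],\dots,\theta^{(m)}[j]$, computed by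 a fixed measurable rule whose interval contains at least a fraction $1-\alpha$ of the $m$ samples. Output $(\theta_L,\theta_R)$. Then in the differential privacy mode the algorithm satisfies $(\phi_1+\phi_2+\phi_3)$-differential privacy, and it satisfies $\bigl(\frac{\phi_1^2}{2}+\phi_2+\phi_3\bigr)$-zCDP (in the zCDP mode, and also in the differential privacy mode). -/

import Mathlib

open MeasureTheory ProbabilityTheory
open scoped ENNReal NNReal Matrix

noncomputable section

namespace PrivCI

/-! ### Databases -/

/-- A record: a feature vector in the unit ball of `ℝ^d` and a target in `{-1, 1}`. -/
structure Record (d : ℕ) where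
  x : EuclideanSpace ℝ (Fin d)
  y : ℝ
  norm_x_le : ‖x‖ ≤ 1
  y_mem : y = 1 ∨ y = -1

/-- A database of `n` records. -/
abbrev Database (d n : ℕ) : Type := Fin n → Record d

/-- Two databases differ on the value of (at most) a single record. -/
def Neighbor {d n : ℕ} (D D' : Database d n) : Prop :=
  ∃ i, ∀ j, j ≠ i → D j = D' j

/-! ### Privacy notions -/

/-- A mechanism, given by the output law on each database, is a genuine randomized mechanism if
each of these laws is a probability measure. -/
def IsMechanism {d n : ℕ} {Ω : Type*} [MeasurableSpace Ω] (M : Database d n → Measure Ω) : Prop :=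
  ∀ D, IsProbabilityMeasure (M D)

/-- Pure `ε`-differential privacy. -/
def IsDP {d n : ℕ} {Ω : Type*} [MeasurableSpace Ω] (ε : ℝ) (M : Database d n → Measure Ω) :
    Prop :=
  IsMechanism M ∧ ∀ D D', Neighbor D D' → ∀ V, MeasurableSet V →
    M D V ≤ ENNReal.ofReal (Real.exp ε) * M D' V

open Classical in
/-- The Rényi divergence `D_a(P ‖ Q) = (a - 1)⁻¹ log ∫ (dP/dQ)^a dQ` of order `a > 1`, equal to
`+∞` if `P` is not absolutely continuous with respect to `Q`. -/
def renyiDiv {Ω : Type*} [MeasurableSpace Ω] (a : ℝ) (P Q : Measure Ω) : EReal :=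
  if P ≪ Q then
    (((a - 1)⁻¹ : ℝ) : EReal) * ENNReal.log (∫⁻ ω, (P.rnDeriv Q ω) ^ a ∂Q)
  else ⊤

/-- `ρ`-zero-concentrated differential privacy. -/
def IsZCDP {d n : ℕ} {Ω : Type*} [MeasurableSpace Ω] (ρ : ℝ) (M : Database d n → Measure Ω) :
    Prop :=
  IsMechanism M ∧ ∀ D D', Neighbor D D' → ∀ a : ℝ, 1 < a →
    renyiDiv a (M D) (M D') ≤ ((ρ * a : ℝ) : EReal)

/-! ### Matrices -/

instance instMeasurableSpaceMatrix {d : ℕ} : MeasurableSpace (Matrix (Fin d) (Fin d) ℝ) :=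
  inferInstanceAs (MeasurableSpace (Fin d → Fin d → ℝ))

/-- A `d × d` matrix as a vector of dimension `d²`, with the Euclidean norm. -/
def toVec {d : ℕ} (M : Matrix (Fin d) (Fin d) ℝ) : EuclideanSpace ℝ (Fin d × Fin d) :=
  WithLp.toLp 2 fun p => M p.1 p.2

/-- Reshape a vector of dimension `d²` to a `d × d` matrix. -/
def toMat {d : ℕ} (v : EuclideanSpace ℝ (Fin d × Fin d)) : Matrix (Fin d) (Fin d) ℝ :=
  Matrix.of fun i j => v (i, j)

/-- The `L₂`-sensitivity of a matrix-valued function of the database: the supremum of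
`‖F D - F D'‖₂` over neighboring databases. -/
def l2Sensitivity {d n : ℕ} (F : Database d n → Matrix (Fin d) (Fin d) ℝ) : ℝ≥0∞ :=
  ⨆ (D : Database d n) (D' : Database d n) (_ : Neighbor D D'), ‖toVec (F D) - toVec (F D')‖ₑ

/-- `(M + Mᵀ) / 2`. -/
def symPart {d : ℕ} (M : Matrix (Fin d) (Fin d) ℝ) : Matrix (Fin d) (Fin d) ℝ :=
  (2⁻¹ : ℝ) • (M + Mᵀ)

theorem symPart_isHermitian {d : ℕ} (M : Matrix (Fin d) (Fin d) ℝ) :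
    (symPart M).IsHermitian := by
  ext i j
  simp [symPart, add_comm, mul_add]

/-- For a symmetric `A = V diag(Λ) Vᵀ`, replace each eigenvalue `Λ i` by `max (Λ i) r`. -/
def clipEigenvalues {d : ℕ} (r : ℝ) (A : Matrix (Fin d) (Fin d) ℝ) (hA : A.IsHermitian) :
    Matrix (Fin d) (Fin d) ℝ :=
  (hA.eigenvectorUnitary : Matrix (Fin d) (Fin d) ℝ) *
    Matrix.diagonal (fun i => max (hA.eigenvalues i) r) *
    (hA.eigenvectorUnitary : Matrix (Fin d) (Fin d) ℝ)ᵀ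

/-! ### Noise distributions -/

/-- The probability law on `ℝ^ι` with density `u⁻¹ exp (-γ ‖b‖₂)`, where `u` is the normalizing
constant (`γ > 0`). -/
def sphericalLaplace (ι : Type*) [Fintype ι] (γ : ℝ) : Measure (EuclideanSpace ℝ ι) :=
  (∫⁻ b : EuclideanSpace ℝ ι, ENNReal.ofReal (Real.exp (-γ * ‖b‖)))⁻¹ •
    (volume : Measure (EuclideanSpace ℝ ι)).withDensity
      fun b => ENNReal.ofReal (Real.exp (-γ * ‖b‖))

/-- The privacy definition for which the matrix noise is calibrated. -/
inductive Mode
  | pureDP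
  | zCDP

open Classical in
/-- The `d²`-dimensional noise vector of `privSPDMat`: spherical Laplace with `γ = φ / s` for pure
differential privacy, `N(0, s² / (2 φ) I)` for zCDP. If the sensitivity `s` is zero, there is no
noise (for the Gaussian this is the meaning of zero variance). -/
def matrixNoise (d : ℕ) (mode : Mode) (s : ℝ≥0) (φ : ℝ) :
    Measure (EuclideanSpace ℝ (Fin d × Fin d)) :=
  match mode with
  | .pureDP =>
      if s = 0 then Measure.dirac 0 else sphericalLaplace (Fin d × Fin d) (φ / s)
  | .zCDP =>
      (Measure.pi fun _ : Fin d × Fin d => gaussianReal 0 (s ^ 2 / (2 * φ.toNNReal))).map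
        (WithLp.toLp 2)

/-- Private symmetric positive definite matrix: output law on the matrix `M`, with sensitivity
`s`, budget `φ` and eigenvalue threshold `2 c`. -/
def privSPDMat {d : ℕ} (mode : Mode) (M : Matrix (Fin d) (Fin d) ℝ) (s : ℝ≥0) (φ c : ℝ) :
    Measure (Matrix (Fin d) (Fin d) ℝ) :=
  (matrixNoise d mode s φ).map fun η =>
    clipEigenvalues (2 * c) (symPart (M + toMat η)) (symPart_isHermitian _)

/-! ### Objective perturbation -/

/-- The loss `θ ↦ f (y θᵀ x)` of a record. -/
def loss {d : ℕ} (f : ℝ → ℝ) (r : Record d) (θ : EuclideanSpace ℝ (Fin d)) : ℝ :=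
  f (r.y * inner ℝ θ r.x)

/-- `J_n(θ) = (1/n) ∑ᵢ [f(xᵢ, yᵢ, θ) + c ‖θ‖²] + (1/n) βᵀ θ`. -/
def objective {d n : ℕ} (f : ℝ → ℝ) (c : ℝ) (D : Database d n) (β θ : EuclideanSpace ℝ (Fin d)) :
    ℝ :=
  (1 / n : ℝ) * ∑ i, (loss f (D i) θ + c * ‖θ‖ ^ 2) + (1 / n : ℝ) * inner ℝ β θ

/-- A minimizer of `g` (it exists and is unique for the objectives considered here). -/
def argmin {d : ℕ} (g : EuclideanSpace ℝ (Fin d) → ℝ) : EuclideanSpace ℝ (Fin d) :=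
  Classical.epsilon fun θ => ∀ θ', g θ ≤ g θ'

/-- `ε' = ε - log (1 + t / (2 n c))`. -/
def epsPrime (n : ℕ) (ε t c : ℝ) : ℝ :=
  ε - Real.log (1 + t / (2 * n * c))

/-- Objective perturbation: output law on the database `D`. -/
def objPerturb {d n : ℕ} (f : ℝ → ℝ) (ε t c : ℝ) (D : Database d n) :
    Measure (EuclideanSpace ℝ (Fin d)) :=
  (sphericalLaplace (Fin d) (epsPrime n ε t c / 2)).map fun β => argmin (objective f c D β)

/-! ### Confidence intervals -/

/-- The Hessian matrix of `g` at `θ`. -/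
def hessian {d : ℕ} (g : EuclideanSpace ℝ (Fin d) → ℝ) (θ : EuclideanSpace ℝ (Fin d)) :
    Matrix (Fin d) (Fin d) ℝ :=
  Matrix.of fun i j =>
    fderiv ℝ (fun w => fderiv ℝ g w (EuclideanSpace.single j 1)) θ (EuclideanSpace.single i 1)

/-- `H[J_n(θ)] = (1/n) ∑ᵢ H[f(xᵢ, yᵢ, θ)] + 2 c I`. -/
def hessianMat {d n : ℕ} (f : ℝ → ℝ) (c : ℝ) (θ : EuclideanSpace ℝ (Fin d)) (D : Database d n) :
    Matrix (Fin d) (Fin d) ℝ :=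
  (1 / n : ℝ) • ∑ i, hessian (loss f (D i)) θ + (2 * c) • (1 : Matrix (Fin d) (Fin d) ℝ)

/-- `Σ = (1/n) ∑ᵢ ∇f(xᵢ, yᵢ, θ) ∇f(xᵢ, yᵢ, θ)ᵀ - 4 c² θ θᵀ`. -/
def covMat {d n : ℕ} (f : ℝ → ℝ) (c : ℝ) (θ : EuclideanSpace ℝ (Fin d)) (D : Database d n) :
    Matrix (Fin d) (Fin d) ℝ :=
  (1 / n : ℝ) • ∑ i, Matrix.vecMulVec (gradient (loss f (D i)) θ).ofLp
      (gradient (loss f (D i)) θ).ofLp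
    - (4 * c ^ 2) • Matrix.vecMulVec θ.ofLp θ.ofLp

/-- A rule that turns `m` real samples into a `(1 - α)`-confidence interval for them: the
interval covers at least a fraction `1 - α` of the samples. -/
structure IsIntervalRule {m : ℕ} (α : ℝ) (ci : (Fin m → ℝ) → ℝ × ℝ) : Prop where
  measurable : Measurable ci
  covers : ∀ z, (1 - α) * m ≤ ({i | z i ∈ Set.Icc (ci z).1 (ci z).2} : Set (Fin m)).ncard

/-- `θ̃ + H̃⁻¹ (G + β / √n) / √n`. -/
def resample {d : ℕ} (n : ℕ) (θ : EuclideanSpace ℝ (Fin d)) (H : Matrix (Fin d) (Fin d) ℝ)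
    (G β : EuclideanSpace ℝ (Fin d)) : EuclideanSpace ℝ (Fin d) :=
  θ + (1 / √n : ℝ) • WithLp.toLp 2 (H⁻¹ *ᵥ (G + (1 / √n : ℝ) • β).ofLp)

/-- Private confidence intervals for models trained with objective perturbation: law of the output
`(θ_L, θ_R)` on the database `D`. Here `m` is the number of post-processing samples, `ci` is the
rule that computes the interval of each coordinate, and `sH θ`, `sC θ` are the sensitivities
passed to `privSPDMat` when the released parameter is `θ`. -/
def confidenceIntervals {d n m : ℕ} (mode : Mode) (f : ℝ → ℝ) (t c φ₁ φ₂ φ₃ : ℝ)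
    (sH sC : EuclideanSpace ℝ (Fin d) → ℝ≥0) (ci : (Fin m → ℝ) → ℝ × ℝ) (D : Database d n) :
    Measure ((Fin d → ℝ) × (Fin d → ℝ)) :=
  (objPerturb f φ₁ t c D).bind fun θ =>
  (privSPDMat mode (hessianMat f c θ D) (sH θ) φ₂ c).bind fun H =>
  (privSPDMat mode (covMat f c θ D) (sC θ) φ₃ c).bind fun S =>
  (Measure.pi fun _ : Fin m => multivariateGaussian 0 S).bind fun G =>
  (Measure.pi fun _ : Fin m => sphericalLaplace (Fin d) (epsPrime n φ₁ t c / 2)).map fun B =>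
    (fun j => (ci fun i => resample n θ H (G i) (B i) j).1,
     fun j => (ci fun i => resample n θ H (G i) (B i) j).2)

end PrivCI

end

/-! The algorithm is an adaptive composition: objective perturbation releases a parameter, two
matrix mechanisms run independently given it, and the rest (`postProcess`) never sees the database.
So it suffices to bound each of the three releases and to have a composition rule.

Objective perturbation: the optimality condition identifies the noise with a function of the
minimizer, and `critNoise` and the minimization map are mutually inverse. Change of variables
(`map_argmin_sphericalLaplace`) gives the output a density proportional to |det `critMat`| ·
exp(-γ‖`critNoise`‖). Changing one record changes the determinant by a factor of at most 1 +
t/(2nc), since each record contributes a rank-one matrix, and moves the noise by at most 2. The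
choice of ε' makes the product of the two effects at most e^{φ₁}, so the likelihood ratio lies in
[e^{-φ₁}, e^{φ₁}].

Matrix mechanisms: changing the database translates the noise by a vector no longer than the
sensitivity at the released parameter. The ratio for spherical Laplace noise follows from the
triangle inequality, the moments for Gaussian noise from its moment generating function.

Composition: pure privacy is domination P ≤ K • Q of measures, and the constants K multiply under
`bind`. For Rényi divergence the bound is dualized (`MomentDom`): a moment bound on dP/dQ is a norm
bound for g ↦ ∫ g dP on L^q(Q). This form passes through `map` and `bind` without computing
densities of composite laws; duality is undone only at the end, by
`MomentDom.lintegral_rnDeriv_rpow_le`. A ratio in [e^{-φ₁}, e^{φ₁}] yields the rate φ₁²/2 by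
replacing z^a with its chord and using that the ratio has mean one. -/

namespace PrivCI

/-! ### Dual form of Rényi moment bounds -/

section MomentDom

variable {Ω Ω' : Type*} [MeasurableSpace Ω] [MeasurableSpace Ω']

/-- The dual form of a bound on the moment `∫ (dP/dQ)^p dQ`, for `q` the conjugate exponent of `p`:
integration against `P` has norm at most `C` as a functional on `L^q(Q)`. -/
def MomentDom (q : ℝ) (C : ℝ≥0∞) (P Q : Measure Ω) : Prop :=
  ∀ g : Ω → ℝ≥0∞, Measurable g → ∫⁻ ω, g ω ∂P ≤ C * (∫⁻ ω, g ω ^ q ∂Q) ^ (1 / q)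

theorem MomentDom.mono {q : ℝ} {C C' : ℝ≥0∞} {P Q : Measure Ω} (h : MomentDom q C P Q)
    (hC : C ≤ C') : MomentDom q C' P Q :=
  fun g hg => (h g hg).trans (by gcongr)

theorem momentDom_withDensity {p q : ℝ} (hpq : p.HolderConjugate q) (Q : Measure Ω)
    {Z : Ω → ℝ≥0∞} (hZ : Measurable Z) :
    MomentDom q ((∫⁻ ω, Z ω ^ p ∂Q) ^ (1 / p)) (Q.withDensity Z) Q := by
  intro g hg
  rw [lintegral_withDensity_eq_lintegral_mul _ hZ hg]
  exact ENNReal.lintegral_mul_le_Lp_mul_Lq Q hpq hZ.aemeasurable hg.aemeasurable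

theorem MomentDom.refl {p q : ℝ} (hpq : p.HolderConjugate q) (Q : Measure Ω)
    [IsProbabilityMeasure Q] : MomentDom q 1 Q Q := by
  have h := momentDom_withDensity hpq Q (Z := 1) measurable_one
  simpa [withDensity_one] using h

/-- Passing to the L^q norm under the probability measure P before changing measure puts K inside
the root; dominating directly would not produce an L^q(Q) norm. -/
theorem MomentDom.of_le_smul {p q : ℝ} (hpq : p.HolderConjugate q) {P Q : Measure Ω}
    [IsProbabilityMeasure P] {K : ℝ≥0∞} (h : P ≤ K • Q) : MomentDom q (K ^ (1 / q)) P Q := by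
  intro g hg
  have hq : 0 ≤ 1 / q := one_div_nonneg.2 hpq.symm.nonneg
  calc ∫⁻ ω, g ω ∂P ≤ 1 * (∫⁻ ω, g ω ^ q ∂P) ^ (1 / q) := MomentDom.refl hpq P g hg
    _ ≤ (∫⁻ ω, g ω ^ q ∂(K • Q)) ^ (1 / q) := by
        rw [one_mul]; exact ENNReal.rpow_le_rpow (lintegral_mono' h le_rfl) hq
    _ = K ^ (1 / q) * (∫⁻ ω, g ω ^ q ∂Q) ^ (1 / q) := by
        rw [lintegral_smul_measure, smul_eq_mul, ENNReal.mul_rpow_of_nonneg _ _ hq]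

theorem MomentDom.map {q : ℝ} {C : ℝ≥0∞} {P Q : Measure Ω} (h : MomentDom q C P Q)
    {F : Ω → Ω'} (hF : Measurable F) : MomentDom q C (P.map F) (Q.map F) := by
  intro g hg
  rw [lintegral_map hg hF, lintegral_map (hg.pow_const q) hF]
  exact h _ (hg.comp hF)

/-- Adaptive composition. The inner bound replaces g by its L^q norm under η ω, as a function of ω;
this is the test function for the outer bound, and its q-th power is the inner integral again. -/
theorem MomentDom.bind {q : ℝ} (hq : 0 < q) {C₁ C₂ : ℝ≥0∞} {P Q : Measure Ω}
    (h : MomentDom q C₁ P Q) {κ η : Ω → Measure Ω'} (hκ : Measurable κ) (hη : Measurable η)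
    (hκη : ∀ ω, MomentDom q C₂ (κ ω) (η ω)) :
    MomentDom q (C₁ * C₂) (P.bind κ) (Q.bind η) := by
  intro g hg
  have hgq : Measurable fun ω => g ω ^ q := hg.pow_const q
  have hm : Measurable fun ω => ∫⁻ x, g x ^ q ∂η ω := (Measure.measurable_lintegral hgq).comp hη
  rw [Measure.lintegral_bind hκ.aemeasurable hg.aemeasurable,
    Measure.lintegral_bind hη.aemeasurable hgq.aemeasurable]
  calc ∫⁻ ω, ∫⁻ x, g x ∂κ ω ∂P
      ≤ ∫⁻ ω, C₂ * (∫⁻ x, g x ^ q ∂η ω) ^ (1 / q) ∂P := lintegral_mono fun ω => hκη ω g hg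
    _ = C₂ * ∫⁻ ω, (∫⁻ x, g x ^ q ∂η ω) ^ (1 / q) ∂P :=
        lintegral_const_mul _ (hm.pow_const _)
    _ ≤ C₂ * (C₁ * (∫⁻ ω, ((∫⁻ x, g x ^ q ∂η ω) ^ (1 / q)) ^ q ∂Q) ^ (1 / q)) := by
        gcongr; exact h _ (hm.pow_const _)
    _ = C₁ * C₂ * (∫⁻ ω, ∫⁻ x, g x ^ q ∂η ω ∂Q) ^ (1 / q) := by
        simp_rw [← ENNReal.rpow_mul, one_div, inv_mul_cancel₀ hq.ne', ENNReal.rpow_one]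
        ring

theorem MomentDom.absolutelyContinuous {q : ℝ} (hq : 0 < q) {C : ℝ≥0∞} {P Q : Measure Ω}
    (h : MomentDom q C P Q) : P ≪ Q := by
  refine Measure.AbsolutelyContinuous.mk fun s hs h0 => ?_
  have := h (s.indicator 1) (measurable_one.indicator hs)
  have e : (fun ω => (s.indicator (1 : Ω → ℝ≥0∞) ω) ^ q) = s.indicator 1 := by
    ext ω
    by_cases hω : ω ∈ s <;> simp [hω, hq]
  rw [lintegral_indicator_one hs, e, lintegral_indicator_one hs, h0,
    ENNReal.zero_rpow_of_pos (by positivity), mul_zero] at this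
  exact le_antisymm this zero_le

/-- The converse half of L^p duality: test with Z^(p-1), the extremal function in Hölder's
inequality for the density Z. -/
theorem MomentDom.lintegral_rnDeriv_rpow_le {p q : ℝ} (hpq : p.HolderConjugate q) {C : ℝ≥0∞}
    {P Q : Measure Ω} [IsFiniteMeasure P] [IsFiniteMeasure Q] (h : MomentDom q C P Q) :
    ∫⁻ ω, P.rnDeriv Q ω ^ p ∂Q ≤ C ^ p := by
  have hac := h.absolutelyContinuous hpq.symm.pos
  set Z := P.rnDeriv Q with hZdef
  have hZ : Measurable Z := Measure.measurable_rnDeriv P Q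
  have hp1 : 0 < p - 1 := sub_pos.2 hpq.lt
  have hp : 0 < p := hpq.pos
  -- The test gives I ≤ C · I^(1/q), from which I^(1/q) can be cancelled only if I is finite.
  -- Truncation at N ensures this; monotone convergence removes it.
  have trunc (N : ℕ) : ∫⁻ ω, (min (Z ω) N) ^ p ∂Q ≤ C ^ p := by
    set I := ∫⁻ ω, (min (Z ω) N) ^ p ∂Q with hI
    have hIfin : I ≠ ∞ := by
      refine ne_top_of_le_ne_top ?_ (lintegral_mono (g := fun _ => (N : ℝ≥0∞) ^ p) fun ω =>
        ENNReal.rpow_le_rpow (min_le_right _ _) hp.le)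
      rw [lintegral_const]
      exact ENNReal.mul_ne_top (ENNReal.rpow_ne_top_of_nonneg hp.le (by simp)) (by simp)
    have hm : Measurable fun ω => (min (Z ω) (N : ℝ≥0∞)) ^ (p - 1) :=
      (hZ.min measurable_const).pow_const _
    have key := h _ hm
    have e1 : ∀ x : ℝ≥0∞, (x ^ (p - 1)) ^ q = x ^ p := fun x => by
      rw [← ENNReal.rpow_mul, hpq.sub_one_mul_conj]
    simp_rw [e1] at key
    rw [← Measure.withDensity_rnDeriv_eq P Q hac, ← hZdef,
      lintegral_withDensity_eq_lintegral_mul _ hZ hm, ← hI] at key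
    have low : I ≤ C * I ^ (1 / q) := by
      refine le_trans (lintegral_mono fun ω => ?_) key
      calc (min (Z ω) (N : ℝ≥0∞)) ^ p
          = (min (Z ω) (N : ℝ≥0∞)) * (min (Z ω) (N : ℝ≥0∞)) ^ (p - 1) := by
            conv_lhs => rw [show p = 1 + (p - 1) by ring,
              ENNReal.rpow_add_of_nonneg _ _ zero_le_one hp1.le, ENNReal.rpow_one]
        _ ≤ Z ω * (min (Z ω) (N : ℝ≥0∞)) ^ (p - 1) := by gcongr; exact min_le_left _ _
    rcases eq_or_ne I 0 with h0 | h0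
    · rw [h0]; exact zero_le
    have hq' : I ^ (1 / q) ≠ 0 := by simp [h0, hIfin]
    have hq'' : I ^ (1 / q) ≠ ∞ :=
      ENNReal.rpow_ne_top_of_nonneg (one_div_nonneg.2 hpq.symm.nonneg) hIfin
    have split : I = I ^ (1 / p) * I ^ (1 / q) := by
      rw [← ENNReal.rpow_add _ _ h0 hIfin, one_div, one_div, hpq.inv_add_inv_eq_one,
        ENNReal.rpow_one]
    have : I ^ (1 / p) ≤ C := by
      refine (ENNReal.mul_le_mul_iff_left hq' hq'').1 ?_
      rw [← split]; exact low
    calc I = (I ^ (1 / p)) ^ p := by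
          rw [← ENNReal.rpow_mul, one_div, inv_mul_cancel₀ hp.ne', ENNReal.rpow_one]
      _ ≤ C ^ p := ENNReal.rpow_le_rpow this hp.le
  have hsup : ∀ ω, Z ω ^ p = ⨆ N : ℕ, (min (Z ω) (N : ℝ≥0∞)) ^ p := by
    intro ω
    have hmono : Monotone fun N : ℕ => (min (Z ω) (N : ℝ≥0∞)) ^ p := fun a b hab =>
      ENNReal.rpow_le_rpow (min_le_min le_rfl (by exact_mod_cast hab)) hp.le
    refine tendsto_nhds_unique ?_ (tendsto_atTop_iSup hmono)
    refine ((ENNReal.continuous_rpow_const (y := p)).tendsto _).comp ?_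
    have : Filter.Tendsto (fun N : ℕ => min (Z ω) (N : ℝ≥0∞)) Filter.atTop (nhds (min (Z ω) ⊤)) :=
      tendsto_const_nhds.min ENNReal.tendsto_nat_nhds_top
    simpa using this
  simp_rw [hsup]
  rw [lintegral_iSup (fun N => (hZ.min measurable_const).pow_const _)]
  · exact iSup_le trunc
  · exact fun a b hab ω =>
      ENNReal.rpow_le_rpow (min_le_min le_rfl (by exact_mod_cast hab)) hp.le

theorem MomentDom.renyiDiv_le {a q ρ : ℝ} (haq : a.HolderConjugate q) {P Q : Measure Ω}
    [IsFiniteMeasure P] [IsFiniteMeasure Q]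
    (h : MomentDom q (ENNReal.ofReal (Real.exp (ρ * (a - 1)))) P Q) :
    renyiDiv a P Q ≤ ((ρ * a : ℝ) : EReal) := by
  have ha : 0 < a - 1 := sub_pos.2 haq.lt
  rw [renyiDiv, if_pos (h.absolutelyContinuous haq.symm.pos)]
  have hI := h.lintegral_rnDeriv_rpow_le haq
  rw [ENNReal.ofReal_rpow_of_pos (Real.exp_pos _), ← Real.exp_mul] at hI
  have hlog := ENNReal.log_le_log hI
  rw [ENNReal.log_ofReal_of_pos (Real.exp_pos _), Real.log_exp] at hlog
  calc (((a - 1)⁻¹ : ℝ) : EReal) * ENNReal.log (∫⁻ ω, (P.rnDeriv Q ω) ^ a ∂Q)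
      ≤ (((a - 1)⁻¹ : ℝ) : EReal) * ((ρ * (a - 1) * a : ℝ) : EReal) :=
        mul_le_mul_of_nonneg_left hlog (by exact_mod_cast (inv_pos.2 ha).le)
    _ = ((ρ * a : ℝ) : EReal) := by
        rw [← EReal.coe_mul]; congr 1; field_simp

end MomentDom

/-! ### Domination of measures under `map` and `bind` -/

section Domination

variable {Ω Ω' : Type*} [MeasurableSpace Ω] [MeasurableSpace Ω']

theorem map_le_smul_map {P Q : Measure Ω} {K : ℝ≥0∞} (h : P ≤ K • Q) {F : Ω → Ω'}
    (hF : Measurable F) : P.map F ≤ K • Q.map F := by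
  rw [← Measure.map_smul]
  exact Measure.map_mono h hF

theorem bind_le_smul_bind {P Q : Measure Ω} {K₁ K₂ : ℝ≥0∞} (h : P ≤ K₁ • Q)
    {κ η : Ω → Measure Ω'} (hκ : Measurable κ) (hη : Measurable η)
    (hκη : ∀ ω, κ ω ≤ K₂ • η ω) : P.bind κ ≤ (K₁ * K₂) • Q.bind η := by
  refine Measure.le_iff.2 fun s hs => ?_
  have hm : Measurable fun ω => η ω s := (Measure.measurable_coe hs).comp hη
  rw [Measure.smul_apply, Measure.bind_apply hs hκ.aemeasurable,
    Measure.bind_apply hs hη.aemeasurable, smul_eq_mul]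
  calc ∫⁻ ω, κ ω s ∂P ≤ ∫⁻ ω, K₂ * η ω s ∂(K₁ • Q) :=
        lintegral_mono' h fun ω => hκη ω s
    _ = K₁ * K₂ * ∫⁻ ω, η ω s ∂Q := by
        rw [lintegral_smul_measure, lintegral_const_mul _ hm, smul_eq_mul, mul_assoc]

theorem isProbabilityMeasure_bind {P : Measure Ω} [IsProbabilityMeasure P] {κ : Ω → Measure Ω'}
    (hκ : Measurable κ) (h : ∀ ω, IsProbabilityMeasure (κ ω)) :
    IsProbabilityMeasure (P.bind κ) := by
  constructor
  rw [Measure.bind_apply MeasurableSet.univ hκ.aemeasurable]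
  simp

end Domination

/-! ### Measurable dependence of laws on parameters -/

section Measurability

variable {α β γ : Type*} [MeasurableSpace α] [MeasurableSpace β] [MeasurableSpace γ]

theorem measurable_map_param (μ : Measure β) [SFinite μ] {F : α → β → γ}
    (hF : Measurable (Function.uncurry F)) : Measurable fun a => μ.map (F a) := by
  have h : ∀ a, μ.map (F a) = (μ.map (Prod.mk a)).map (Function.uncurry F) := fun a => by
    rw [Measure.map_map hF measurable_prodMk_left]; rfl
  simp_rw [h]
  exact (Measure.measurable_map _ hF).comp Measurable.map_prodMk_left

theorem measurable_map_kernel {κ : α → Measure β} (hκ : Measurable κ)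
    (hp : ∀ a, IsProbabilityMeasure (κ a)) {F : α → β → γ} (hF : Measurable (Function.uncurry F)) :
    Measurable fun a => (κ a).map (F a) := by
  refine Measure.measurable_of_measurable_coe _ fun s hs => ?_
  let k : Kernel α β := ⟨κ, hκ⟩
  have : IsMarkovKernel k := ⟨hp⟩
  have h : ∀ a, (κ a).map (F a) s = k a (Prod.mk a ⁻¹' (Function.uncurry F ⁻¹' s)) := fun a => by
    have hFa : Measurable (F a) := hF.comp measurable_prodMk_left
    rw [Measure.map_apply hFa hs]; rfl
  simp_rw [h]
  exact Kernel.measurable_kernel_prodMk_left (hF hs)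

theorem measurable_bind_kernel {κ : α → Measure β} (hκ : Measurable κ)
    (hp : ∀ a, IsProbabilityMeasure (κ a)) {η : α → β → Measure γ}
    (hη : Measurable (Function.uncurry η)) : Measurable fun a => (κ a).bind (η a) := by
  exact Measure.measurable_join.comp (measurable_map_kernel hκ hp hη)

end Measurability

/-! ### From bounded likelihood ratios to Rényi moments -/

section PureToConcentrated

theorem sinh_le_mul_cosh {u : ℝ} (hu : 0 ≤ u) : Real.sinh u ≤ u * Real.cosh u := by
  have hd : ∀ x : ℝ, HasDerivAt (fun x => x * Real.cosh x - Real.sinh x) (x * Real.sinh x) x := by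
    intro x
    exact (((hasDerivAt_id' x).mul (Real.hasDerivAt_cosh x)).sub
      (Real.hasDerivAt_sinh x)).congr_deriv (by ring)
  have hm : MonotoneOn (fun x : ℝ => x * Real.cosh x - Real.sinh x) (Set.Ici 0) := by
    refine monotoneOn_of_deriv_nonneg (convex_Ici 0)
      (fun x _ => (hd x).continuousAt.continuousWithinAt)
      (fun x _ => (hd x).differentiableAt.differentiableWithinAt) fun x hx => ?_
    rw [interior_Ici, Set.mem_Ioi] at hx
    rw [(hd x).deriv]
    exact mul_nonneg hx.le (Real.sinh_nonneg_iff.2 hx.le)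
  have := hm (Set.mem_Ici.2 le_rfl) (Set.mem_Ici.2 hu) hu
  simp at this
  linarith

theorem antitoneOn_cosh_mul_exp :
    AntitoneOn (fun u : ℝ => Real.cosh u * Real.exp (-(u ^ 2 / 2))) (Set.Ici 0) := by
  have hd : ∀ x : ℝ, HasDerivAt (fun u : ℝ => Real.cosh u * Real.exp (-(u ^ 2 / 2)))
      ((Real.sinh x - x * Real.cosh x) * Real.exp (-(x ^ 2 / 2))) x := by
    intro x
    have h1 : HasDerivAt (fun u : ℝ => -(u ^ 2 / 2)) (-x) x :=
      (((hasDerivAt_id' x).fun_pow 2).div_const 2).fun_neg.congr_deriv (by simp)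
    exact ((Real.hasDerivAt_cosh x).mul h1.exp).congr_deriv (by ring)
  refine antitoneOn_of_deriv_nonpos (convex_Ici 0)
      (fun x _ => (hd x).continuousAt.continuousWithinAt)
      (fun x _ => (hd x).differentiableAt.differentiableWithinAt) fun x hx => ?_
  rw [interior_Ici, Set.mem_Ioi] at hx
  rw [(hd x).deriv]
  exact mul_nonpos_of_nonpos_of_nonneg (sub_nonpos.2 (sinh_le_mul_cosh hx.le)) (Real.exp_pos _).le

/-- With u = (a - 1/2)ε and v = ε/2 the quotient is cosh u / cosh v, and the exponent on the right
is (u² - v²)/2. The claim is thus that cosh x · exp(-x²/2) does not increase from v to u. -/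
theorem sinh_sub_sinh_div_le {a ε : ℝ} (ha : 1 ≤ a) (hε : 0 < ε) :
    (Real.sinh (a * ε) - Real.sinh ((a - 1) * ε)) / Real.sinh ε
      ≤ Real.exp (a * (a - 1) * ε ^ 2 / 2) := by
  set u := (a - 1 / 2) * ε with hu
  set v := ε / 2 with hv
  have hv0 : 0 < v := by positivity
  have huv : v ≤ u := by rw [hu, hv]; nlinarith
  have e1 : a * ε = u + v := by rw [hu, hv]; ring
  have e2 : (a - 1) * ε = u - v := by rw [hu, hv]; ring
  have e3 : ε = 2 * v := by rw [hv]; ring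
  have hs : 0 < Real.sinh v := Real.sinh_pos_iff.2 hv0
  have hc := Real.cosh_pos v
  have key := antitoneOn_cosh_mul_exp (Set.mem_Ici.2 hv0.le) (Set.mem_Ici.2 (hv0.le.trans huv)) huv
  have hE : Real.exp (a * (a - 1) * ε ^ 2 / 2) = Real.exp (u ^ 2 / 2) * Real.exp (-(v ^ 2 / 2)) := by
    rw [← Real.exp_add, hu, hv]; congr 1; ring
  rw [e1, e2, hE, Real.sinh_add, Real.sinh_sub, show Real.sinh ε = 2 * Real.sinh v * Real.cosh v by
    rw [e3, Real.sinh_two_mul], div_le_iff₀ (by positivity)]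
  have h2 : Real.cosh u ≤ Real.cosh v * Real.exp (-(v ^ 2 / 2)) * Real.exp (u ^ 2 / 2) := by
    have h3 := mul_le_mul_of_nonneg_right key (Real.exp_pos (u ^ 2 / 2)).le
    simp only [mul_assoc, ← Real.exp_add] at h3 ⊢
    simpa using h3
  nlinarith [mul_le_mul_of_nonneg_left h2 hs.le]

theorem rpow_le_chord {a l r z : ℝ} (ha : 1 ≤ a) (hl : 0 ≤ l) (hlr : l < r) (h1 : l ≤ z)
    (h2 : z ≤ r) :
    z ^ a ≤ (r * l ^ a - l * r ^ a) / (r - l) + (r ^ a - l ^ a) / (r - l) * z := by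
  have hd : 0 < r - l := sub_pos.2 hlr
  have h := (convexOn_rpow ha).2 (Set.mem_Ici.2 hl) (Set.mem_Ici.2 (hl.trans hlr.le))
    (div_nonneg (sub_nonneg.2 h2) hd.le) (div_nonneg (sub_nonneg.2 h1) hd.le)
    (by rw [← add_div]; rw [div_eq_one_iff_eq hd.ne']; ring)
  have e : ((r - z) / (r - l)) • l + ((z - l) / (r - l)) • r = z := by
    simp only [smul_eq_mul]; field_simp; ring
  rw [e] at h
  refine h.trans (le_of_eq ?_)
  simp only [smul_eq_mul]; field_simp; ring

/-- A likelihood ratio with values in `[e^{-ε}, e^ε]` has `a`-th moment at most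
`e^{a (a - 1) ε² / 2}`. -/
theorem lintegral_rpow_le_of_ratio_mem {Ω : Type*} [MeasurableSpace Ω] {Q : Measure Ω}
    [IsProbabilityMeasure Q] {Z : Ω → ℝ} (hZ : Measurable Z) {a ε : ℝ} (ha : 1 < a) (hε : 0 < ε)
    (hl : ∀ ω, Real.exp (-ε) ≤ Z ω) (hr : ∀ ω, Z ω ≤ Real.exp ε)
    (hone : ∫⁻ ω, ENNReal.ofReal (Z ω) ∂Q = 1) :
    ∫⁻ ω, ENNReal.ofReal (Z ω) ^ a ∂Q ≤ ENNReal.ofReal (Real.exp (a * (a - 1) * ε ^ 2 / 2)) := by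
  have hpos : ∀ ω, 0 < Z ω := fun ω => (Real.exp_pos _).trans_le (hl ω)
  have hZint : Integrable Z Q := by
    refine Integrable.of_bound hZ.aestronglyMeasurable (Real.exp ε) (ae_of_all _ fun ω => ?_)
    rw [Real.norm_of_nonneg (hpos ω).le]; exact hr ω
  have hZone : ∫ ω, Z ω ∂Q = 1 := by
    rw [integral_eq_lintegral_of_nonneg_ae (ae_of_all _ fun ω => (hpos ω).le)
      hZ.aestronglyMeasurable, hone, ENNReal.toReal_one]
  have hZa : Integrable (fun ω => Z ω ^ a) Q := by
    refine Integrable.of_bound (hZ.pow_const a).aestronglyMeasurable (Real.exp ε ^ a)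
      (ae_of_all _ fun ω => ?_)
    rw [Real.norm_of_nonneg (Real.rpow_nonneg (hpos ω).le a)]
    exact Real.rpow_le_rpow (hpos ω).le (hr ω) (by linarith)
  have hlr : Real.exp (-ε) < Real.exp ε := Real.exp_lt_exp.2 (by linarith)
  simp_rw [fun ω => ENNReal.ofReal_rpow_of_pos (p := a) (hpos ω)]
  rw [← ofReal_integral_eq_lintegral_ofReal hZa
    (ae_of_all _ fun ω => Real.rpow_nonneg (hpos ω).le a)]
  refine ENNReal.ofReal_le_ofReal ?_
  refine le_trans ?_ (sinh_sub_sinh_div_le ha.le hε)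
  set l := Real.exp (-ε) with hl'
  set r := Real.exp ε with hr'
  -- The chord bound is affine in Z, so its integral depends only on the mean of Z, which is one;
  -- the result is the moment of the two-point law on e^{-ε}, e^ε with mean one.
  calc ∫ ω, Z ω ^ a ∂Q
      ≤ ∫ ω, ((r * l ^ a - l * r ^ a) / (r - l) + (r ^ a - l ^ a) / (r - l) * Z ω) ∂Q :=
        integral_mono hZa ((integrable_const _).add (hZint.const_mul _))
          fun ω => rpow_le_chord ha.le (Real.exp_pos _).le hlr (hl ω) (hr ω)
    _ = (r * l ^ a - l * r ^ a) / (r - l) + (r ^ a - l ^ a) / (r - l) := by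
        rw [integral_add (integrable_const _) (hZint.const_mul _), integral_const_mul, hZone]
        simp
    _ = (Real.sinh (a * ε) - Real.sinh ((a - 1) * ε)) / Real.sinh ε := by
        have h1 : r * l ^ a = Real.exp (-((a - 1) * ε)) := by
          rw [hl', hr', ← Real.exp_mul, ← Real.exp_add]; congr 1; ring
        have h2 : l * r ^ a = Real.exp ((a - 1) * ε) := by
          rw [hl', hr', ← Real.exp_mul, ← Real.exp_add]; congr 1; ring
        have h3 : r ^ a = Real.exp (a * ε) := by rw [hr', ← Real.exp_mul, mul_comm]
        have h4 : l ^ a = Real.exp (-(a * ε)) := by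
          rw [hl', ← Real.exp_mul]; congr 1; ring
        have hd : r - l ≠ 0 := (sub_pos.2 hlr).ne'
        rw [h1, h2, h3, h4, Real.sinh_eq, Real.sinh_eq, Real.sinh_eq, ← hl', ← hr']
        field_simp
        ring

end PureToConcentrated

/-! ### Spherical Laplace noise -/

section SphericalLaplace

variable {ι : Type*} [Fintype ι]

theorem lintegral_exp_neg_mul_norm_ne_top {γ : ℝ} (hγ : 0 < γ) :
    ∫⁻ b : EuclideanSpace ℝ ι, ENNReal.ofReal (Real.exp (-γ * ‖b‖)) ≠ ∞ := by
  -- Any exponent above the dimension makes (1 + ‖b‖)^(-k) integrable; y^k / k! ≤ e^y compares the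
  -- exponential with it.
  set k : ℕ := Module.finrank ℝ (EuclideanSpace ℝ ι) + 1 with hk
  have hint := integrable_one_add_norm (E := EuclideanSpace ℝ ι) (μ := volume) (r := k)
    (by rw [hk]; push_cast; linarith)
  have hint' : Integrable (fun b : EuclideanSpace ℝ ι => Real.exp (-γ * ‖b‖)) := by
    refine (hint.const_mul (Real.exp γ * k.factorial / γ ^ k)).mono'
      (by fun_prop) (ae_of_all _ fun b => ?_)
    rw [Real.norm_of_nonneg (Real.exp_pos _).le, Real.rpow_neg (by positivity), Real.rpow_natCast]
    have h := Real.pow_div_factorial_le_exp (γ * (1 + ‖b‖)) (by positivity) k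
    have he : Real.exp (-γ * ‖b‖) = Real.exp γ * (Real.exp (γ * (1 + ‖b‖)))⁻¹ := by
      rw [← Real.exp_neg, ← Real.exp_add]; congr 1; ring
    have hb : 0 < 1 + ‖b‖ := by positivity
    rw [he, mul_div_assoc, mul_assoc]
    gcongr
    calc (Real.exp (γ * (1 + ‖b‖)))⁻¹ ≤ ((γ * (1 + ‖b‖)) ^ k / k.factorial)⁻¹ := by gcongr
      _ = k.factorial / γ ^ k * ((1 + ‖b‖) ^ k)⁻¹ := by rw [mul_pow]; field_simp
  exact ((hasFiniteIntegral_iff_ofReal (ae_of_all _ fun b => (Real.exp_pos _).le)).1 hint'.2).ne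

theorem lintegral_exp_neg_mul_norm_ne_zero (γ : ℝ) :
    ∫⁻ b : EuclideanSpace ℝ ι, ENNReal.ofReal (Real.exp (-γ * ‖b‖)) ≠ 0 := by
  intro h
  rw [lintegral_eq_zero_iff (by fun_prop)] at h
  have h0 : (volume : Measure (EuclideanSpace ℝ ι)) Set.univ = 0 := by
    refine measure_mono_null (fun b _ => ?_) h
    simp [Real.exp_pos]
  exact (NeZero.ne (volume : Measure (EuclideanSpace ℝ ι))) (Measure.measure_univ_eq_zero.1 h0)

theorem isProbabilityMeasure_sphericalLaplace {γ : ℝ} (hγ : 0 < γ) :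
    IsProbabilityMeasure (sphericalLaplace ι γ) := by
  constructor
  rw [sphericalLaplace, Measure.smul_apply, withDensity_apply _ MeasurableSet.univ,
    Measure.restrict_univ, smul_eq_mul]
  exact ENNReal.inv_mul_cancel (lintegral_exp_neg_mul_norm_ne_zero γ)
    (lintegral_exp_neg_mul_norm_ne_top hγ)

theorem sphericalLaplace_map_add_le {γ : ℝ} (hγ : 0 ≤ γ) (v : EuclideanSpace ℝ ι) :
    (sphericalLaplace ι γ).map (· + v)
      ≤ ENNReal.ofReal (Real.exp (γ * ‖v‖)) • sphericalLaplace ι γ := by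
  refine Measure.le_iff.2 fun s hs => ?_
  have hadd : Measurable fun b : EuclideanSpace ℝ ι => b + v := by fun_prop
  rw [Measure.map_apply hadd hs, sphericalLaplace, Measure.smul_apply, Measure.smul_apply,
    Measure.smul_apply, withDensity_apply _ (hadd hs), withDensity_apply _ hs, smul_eq_mul,
    smul_eq_mul, smul_eq_mul, mul_left_comm]
  gcongr
  have hmp := measurePreserving_add_right (volume : Measure (EuclideanSpace ℝ ι)) v
  have hcomp := hmp.setLIntegral_comp_preimage hs
    (f := fun b => ENNReal.ofReal (Real.exp (-γ * ‖b - v‖))) (by fun_prop)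
  simp only [add_sub_cancel_right] at hcomp
  rw [hcomp, ← lintegral_const_mul _ (by fun_prop)]
  refine lintegral_mono fun b => ?_
  rw [← ENNReal.ofReal_mul (Real.exp_pos _).le, ← Real.exp_add]
  refine ENNReal.ofReal_le_ofReal (Real.exp_le_exp.2 ?_)
  have := norm_le_norm_sub_add b v
  nlinarith

theorem measurable_sphericalLaplace : Measurable fun γ : ℝ => sphericalLaplace ι γ := by
  have hm : Measurable fun p : ℝ × EuclideanSpace ℝ ι =>
      ENNReal.ofReal (Real.exp (-p.1 * ‖p.2‖)) := by fun_prop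
  refine Measure.measurable_of_measurable_coe _ fun s hs => ?_
  simp only [sphericalLaplace, Measure.smul_apply, withDensity_apply _ hs, smul_eq_mul]
  exact (hm.lintegral_prod_right' (ν := volume)).inv.mul
    (hm.lintegral_prod_right' (ν := volume.restrict s))

end SphericalLaplace

/-! ### Rényi moments of shifted Gaussian noise -/

section Gaussian

theorem gaussianReal_eq_withDensity {v : ℝ≥0} (hv : v ≠ 0) (m : ℝ) :
    gaussianReal m v = (gaussianReal 0 v).withDensity fun x =>
      ENNReal.ofReal (Real.exp (m * x / v - m ^ 2 / (2 * v))) := by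
  have hv' : (v : ℝ) ≠ 0 := by exact_mod_cast hv
  rw [gaussianReal_of_var_ne_zero _ hv, gaussianReal_of_var_ne_zero _ hv,
    ← withDensity_mul _ (measurable_gaussianPDF _ _) (by fun_prop)]
  congr 1
  ext x
  simp only [Pi.mul_apply, gaussianPDF, gaussianPDFReal]
  rw [← ENNReal.ofReal_mul (by positivity), mul_assoc (_⁻¹), ← Real.exp_add]
  congr 3
  field_simp
  ring

theorem lintegral_gaussian_ratio_rpow {v : ℝ≥0} (hv : v ≠ 0) (m a : ℝ) :
    ∫⁻ x, ENNReal.ofReal (Real.exp (m * x / v - m ^ 2 / (2 * v))) ^ a ∂gaussianReal 0 v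
      = ENNReal.ofReal (Real.exp (a * (a - 1) * m ^ 2 / (2 * v))) := by
  have hv' : (v : ℝ) ≠ 0 := by exact_mod_cast hv
  have e : ∀ x : ℝ, ENNReal.ofReal (Real.exp (m * x / v - m ^ 2 / (2 * v))) ^ a
      = ENNReal.ofReal (Real.exp (-(a * m ^ 2 / (2 * v))) * Real.exp (a * m / v * x)) := by
    intro x
    rw [ENNReal.ofReal_rpow_of_pos (Real.exp_pos _), ← Real.exp_mul, ← Real.exp_add]
    congr 2; ring
  simp_rw [e]
  have hint := (integrable_exp_mul_gaussianReal (μ := 0) (v := v) (a * m / v)).const_mul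
    (Real.exp (-(a * m ^ 2 / (2 * v))))
  rw [← ofReal_integral_eq_lintegral_ofReal hint (ae_of_all _ fun x => by positivity),
    integral_const_mul]
  have hmgf := mgf_gaussianReal (p := gaussianReal 0 v) (X := id) (μ := 0) (v := v)
    (by simp) (a * m / v)
  simp only [mgf, id] at hmgf
  rw [hmgf, ← Real.exp_add]
  congr 2
  field_simp
  ring

variable {ι : Type*} [Fintype ι]

theorem lintegral_pi_prod_eq {X : ι → Type*} [∀ i, MeasurableSpace (X i)]
    (μ : ∀ i, Measure (X i)) [∀ i, IsProbabilityMeasure (μ i)] {h : ∀ i, X i → ℝ≥0∞}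
    (hh : ∀ i, Measurable (h i)) :
    ∫⁻ x, ∏ i, h i (x i) ∂Measure.pi μ = ∏ i, ∫⁻ x, h i x ∂μ i := by
  refine (lintegral_prod_eq_prod_lintegral_of_indepFun Finset.univ
    (fun i (x : ∀ i, X i) => h i (x i))
    (iIndepFun_pi fun i => (hh i).aemeasurable)
    fun i => (hh i).comp (measurable_pi_apply i)).trans ?_
  refine Finset.prod_congr rfl fun i _ => ?_
  rw [← (measurePreserving_eval μ i).map_eq, lintegral_map (hh i) (measurable_pi_apply i)]

theorem pi_withDensity_eq {X : ι → Type*} [∀ i, MeasurableSpace (X i)]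
    (μ : ∀ i, Measure (X i)) [∀ i, IsProbabilityMeasure (μ i)] {h : ∀ i, X i → ℝ≥0∞}
    (hh : ∀ i, Measurable (h i)) [∀ i, IsProbabilityMeasure ((μ i).withDensity (h i))] :
    Measure.pi (fun i => (μ i).withDensity (h i))
      = (Measure.pi μ).withDensity fun x => ∏ i, h i (x i) := by
  refine Measure.pi_eq fun s hs => ?_
  rw [withDensity_apply _ (MeasurableSet.univ_pi hs),
    ← lintegral_indicator (MeasurableSet.univ_pi hs)]
  have e : ((Set.univ.pi s).indicator fun x => ∏ i, h i (x i))
      = fun x => ∏ i, (s i).indicator (h i) (x i) := by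
    ext x
    by_cases hx : ∀ i, x i ∈ s i
    · rw [Set.indicator_of_mem (by simpa using hx)]
      exact Finset.prod_congr rfl fun i _ => (Set.indicator_of_mem (hx i) _).symm
    · rw [Set.indicator_of_notMem (by simpa using hx)]
      obtain ⟨i, hi⟩ := not_forall.1 hx
      exact (Finset.prod_eq_zero (Finset.mem_univ i) (Set.indicator_of_notMem hi _)).symm
  rw [e, lintegral_pi_prod_eq μ fun i => (hh i).indicator (hs i)]
  refine Finset.prod_congr rfl fun i _ => ?_
  rw [withDensity_apply _ (hs i), lintegral_indicator (hs i)]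

/-- A shift of the product Gaussian has a product density, so the a-th moments of the coordinates
multiply and their exponents add. The root 1/a in the dual norm cancels the factor a. -/
theorem momentDom_pi_gaussian_map_add {v : ℝ≥0} (hv : v ≠ 0) {a q : ℝ} (haq : a.HolderConjugate q)
    (m : ι → ℝ) :
    MomentDom q (ENNReal.ofReal (Real.exp ((a - 1) * (∑ i, m i ^ 2) / (2 * v))))
      ((Measure.pi fun _ : ι => gaussianReal 0 v).map (· + m))
      (Measure.pi fun _ : ι => gaussianReal 0 v) := by
  have hv' : (v : ℝ) ≠ 0 := by exact_mod_cast hv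
  set h : ι → ℝ → ℝ≥0∞ := fun i x => ENNReal.ofReal (Real.exp (m i * x / v - m i ^ 2 / (2 * v)))
    with hdef
  have hh : ∀ i, Measurable (h i) := fun i => by fun_prop
  have hw : ∀ i, (gaussianReal 0 v).map (· + m i) = (gaussianReal 0 v).withDensity (h i) := by
    intro i
    rw [gaussianReal_map_add_const, zero_add]
    exact gaussianReal_eq_withDensity hv (m i)
  have : ∀ i, IsProbabilityMeasure ((gaussianReal 0 v).withDensity (h i)) := fun i => by
    rw [← hw]; exact Measure.isProbabilityMeasure_map (by fun_prop)
  have hshift : (Measure.pi fun _ : ι => gaussianReal 0 v).map (· + m)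
      = (Measure.pi fun _ : ι => gaussianReal 0 v).withDensity fun x => ∏ i, h i (x i) := by
    rw [← pi_withDensity_eq _ hh]
    simp_rw [← hw]
    have : ∀ i, SigmaFinite ((gaussianReal 0 v).map (· + m i)) := fun i => by
      rw [hw]; infer_instance
    exact Measure.pi_map_pi (μ := fun _ : ι => gaussianReal 0 v) (f := fun i x => x + m i)
      fun i => by fun_prop
  rw [hshift]
  refine (momentDom_withDensity haq _ (by fun_prop)).mono (le_of_eq ?_)
  simp_rw [← ENNReal.prod_rpow_of_nonneg haq.nonneg]
  rw [lintegral_pi_prod_eq _ fun i => (hh i).pow_const a]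
  simp_rw [hdef, lintegral_gaussian_ratio_rpow hv]
  rw [← ENNReal.ofReal_prod_of_nonneg fun i _ => (Real.exp_pos _).le, ← Real.exp_sum,
    ENNReal.ofReal_rpow_of_pos (Real.exp_pos _), ← Real.exp_mul, ← Finset.sum_div,
    ← Finset.mul_sum]
  congr 2
  have := haq.ne_zero
  field_simp

end Gaussian

/-! ### Measurability of spectral matrix functions -/

section MatrixFunctions

variable {d : ℕ}

instance : BorelSpace (Matrix (Fin d) (Fin d) ℝ) :=
  inferInstanceAs (BorelSpace (Fin d → Fin d → ℝ))

instance : TopologicalSpace.PseudoMetrizableSpace (Matrix (Fin d) (Fin d) ℝ) :=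
  inferInstanceAs (TopologicalSpace.PseudoMetrizableSpace (Fin d → Fin d → ℝ))

theorem measurable_matrix_iff {α : Type*} [MeasurableSpace α]
    {F : α → Matrix (Fin d) (Fin d) ℝ} :
    Measurable F ↔ ∀ i j, Measurable fun a => F a i j :=
  ⟨fun h i j => (measurable_pi_apply j).comp ((measurable_pi_apply i).comp h),
    fun h => measurable_pi_iff.2 fun i => measurable_pi_iff.2 fun j => h i j⟩

theorem measurable_matrix_of_continuous {α : Type*} [TopologicalSpace α] [MeasurableSpace α]
    [OpensMeasurableSpace α] {F : α → Matrix (Fin d) (Fin d) ℝ} (hF : Continuous F) :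
    Measurable F :=
  hF.measurable

/-- One sequence serves all matrices: the k-th polynomial is within 1/(k + 1) of h on [-k, k], and
every spectrum eventually lies in that interval. Functions of matrices become pointwise limits of
polynomials, hence measurable. -/
theorem exists_polynomial_tendsto_cfc {h : ℝ → ℝ} (hh : Continuous h) :
    ∃ p : ℕ → Polynomial ℝ, ∀ A : Matrix (Fin d) (Fin d) ℝ, A.IsHermitian →
      Filter.Tendsto (fun k => Polynomial.aeval A (p k)) Filter.atTop (nhds (cfc h A)) := by
  have hp : ∀ k : ℕ, ∃ p : Polynomial ℝ,
      ∀ x ∈ Set.Icc (-(k : ℝ)) k, |p.eval x - h x| < 1 / ((k : ℝ) + 1) := fun k =>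
    exists_polynomial_near_of_continuousOn _ _ h hh.continuousOn _ (by positivity)
  choose p hp using hp
  refine ⟨p, fun A hA => ?_⟩
  have hsa : IsSelfAdjoint A := hA
  have e : ∀ k, Polynomial.aeval A (p k) = cfc (fun x => (p k).eval x) A := fun k =>
    (cfc_polynomial (p k) A hsa).symm
  simp_rw [e]
  refine tendsto_cfc_fun ?_ (Filter.Eventually.of_forall fun k =>
    (p k).continuous.continuousOn)
  obtain ⟨R, hR⟩ := (Matrix.finite_real_spectrum (A := A)).isBounded.subset_closedBall 0
  rw [Metric.tendstoUniformlyOn_iff]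
  intro δ hδ
  obtain ⟨N₁, hN₁⟩ := exists_nat_gt R
  obtain ⟨N₂, hN₂⟩ := exists_nat_one_div_lt hδ
  filter_upwards [Filter.eventually_ge_atTop (max N₁ N₂)] with k hk x hx
  have hk1 : (N₁ : ℝ) ≤ k := by exact_mod_cast (le_max_left _ _).trans hk
  have hk2 : (N₂ : ℝ) ≤ k := by exact_mod_cast (le_max_right _ _).trans hk
  have hxR : |x| ≤ R := by simpa using hR hx
  have hxk := abs_le.1 (hxR.trans (hN₁.le.trans hk1))
  rw [dist_comm, Real.dist_eq]
  refine (hp k x ⟨hxk.1, hxk.2⟩).trans_le (le_trans ?_ hN₂.le)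
  gcongr

/-- The eigenbasis is an arbitrary choice with no evident measurability; the functional calculus
does not depend on it. -/
theorem clipEigenvalues_eq_cfc (r : ℝ) (A : Matrix (Fin d) (Fin d) ℝ) (hA : A.IsHermitian) :
    clipEigenvalues r A hA = cfc (fun x => max x r) A := by
  rw [hA.cfc_eq, Matrix.IsHermitian.cfc, Unitary.conjStarAlgAut_apply]
  rfl

theorem measurable_aeval (p : Polynomial ℝ) :
    Measurable fun A : Matrix (Fin d) (Fin d) ℝ => Polynomial.aeval A p := by
  refine measurable_matrix_of_continuous ?_
  simp_rw [Polynomial.aeval_eq_sum_range]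
  fun_prop

theorem measurable_clip_symPart (r : ℝ) :
    Measurable fun A : Matrix (Fin d) (Fin d) ℝ =>
      clipEigenvalues r (symPart A) (symPart_isHermitian A) := by
  obtain ⟨p, hp⟩ := exists_polynomial_tendsto_cfc (d := d) (h := fun x => max x r) (by fun_prop)
  have hs : Measurable (symPart : Matrix (Fin d) (Fin d) ℝ → _) := by
    refine measurable_matrix_of_continuous ?_
    unfold symPart
    fun_prop
  simp_rw [clipEigenvalues_eq_cfc]
  refine measurable_of_tendsto_metrizable (fun k => (measurable_aeval (p k)).comp hs)
    (tendsto_pi_nhds.2 fun A => hp _ (symPart_isHermitian A))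

open scoped MatrixOrder in
theorem measurable_cfc_sqrt :
    Measurable fun A : Matrix (Fin d) (Fin d) ℝ => CFC.sqrt A := by
  classical
  obtain ⟨p, hp⟩ := exists_polynomial_tendsto_cfc (d := d) (h := fun x => √x) (by fun_prop)
  have hclosed : IsClosed {A : Matrix (Fin d) (Fin d) ℝ | A.PosSemidef} := by
    simp only [Matrix.posSemidef_iff_dotProduct_mulVec, Matrix.IsHermitian]
    simp only [Set.ofPred_and, Set.ofPred_forall]
    refine (isClosed_eq (by fun_prop) (by fun_prop)).inter (isClosed_iInter fun x => ?_)
    exact isClosed_le continuous_const (by fun_prop)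
  have e : (fun A : Matrix (Fin d) (Fin d) ℝ => CFC.sqrt A)
      = {A | A.PosSemidef}.indicator fun A => cfc (fun x => √x) A := by
    ext1 A
    by_cases hA : A.PosSemidef
    · rw [Set.indicator_of_mem (by exact hA), CFC.sqrt_eq_cfc, cfc_nnreal_eq_real _ A hA.nonneg]
      refine cfc_congr fun x hx => ?_
      simp [Real.coe_sqrt, Real.coe_toNNReal _ (spectrum_nonneg_of_nonneg hA.nonneg hx)]
    -- Outside the positive semidefinite cone the functional calculus returns the default value
    -- zero, which the indicator reproduces.
    · rw [Set.indicator_of_notMem (by exact hA), CFC.sqrt, cfcₙ_apply_of_not_predicate]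
      change ¬ (A - 0).PosSemidef
      simpa
  rw [e]
  refine measurable_of_tendsto_metrizable
    (f := fun k => {A | A.PosSemidef}.indicator fun A => Polynomial.aeval A (p k))
    (fun k => (measurable_aeval (p k)).indicator hclosed.measurableSet)
    (tendsto_pi_nhds.2 fun A => ?_)
  by_cases hA : A.PosSemidef
  · simp only [Set.indicator_of_mem (show A ∈ {A | A.PosSemidef} from hA)]
    exact hp A hA.1
  · simp only [Set.indicator_of_notMem (show A ∉ {A | A.PosSemidef} from hA)]
    exact tendsto_const_nhds

theorem measurable_matrix_inv : Measurable fun A : Matrix (Fin d) (Fin d) ℝ => A⁻¹ := by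
  rw [measurable_matrix_iff]
  intro i j
  simp only [Matrix.inv_def, Matrix.smul_apply, Ring.inverse_eq_inv', smul_eq_mul]
  have h1 : Measurable fun A : Matrix (Fin d) (Fin d) ℝ => A.det :=
    (Continuous.matrix_det continuous_id).measurable
  have h2 : Measurable fun A : Matrix (Fin d) (Fin d) ℝ => A.adjugate :=
    measurable_matrix_of_continuous (Continuous.matrix_adjugate continuous_id)
  exact h1.inv.mul (measurable_matrix_iff.1 h2 i j)

theorem measurable_toMat : Measurable (toMat : EuclideanSpace ℝ (Fin d × Fin d) → _) := by
  rw [measurable_matrix_iff]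
  intro i j
  simp only [toMat, Matrix.of_apply]
  fun_prop

theorem measurable_matrix_add {α : Type*} [MeasurableSpace α]
    {F G : α → Matrix (Fin d) (Fin d) ℝ} (hF : Measurable F) (hG : Measurable G) :
    Measurable fun a => F a + G a := by
  rw [measurable_matrix_iff] at *
  exact fun i j => (hF i j).add (hG i j)

end MatrixFunctions

/-! ### Privacy of the matrix noise under translation -/

section MatrixNoise

variable {d : ℕ}

theorem isProbabilityMeasure_matrixNoise (mode : Mode) (s : ℝ≥0) {φ : ℝ} (hφ : 0 < φ) :
    IsProbabilityMeasure (matrixNoise d mode s φ) := by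
  cases mode with
  | pureDP =>
    simp only [matrixNoise]
    split_ifs with h
    · infer_instance
    · exact isProbabilityMeasure_sphericalLaplace (by positivity)
  | zCDP =>
    simp only [matrixNoise]
    exact Measure.isProbabilityMeasure_map (by fun_prop)

theorem measurable_matrixNoise (mode : Mode) (φ : ℝ) :
    Measurable fun s : ℝ≥0 => matrixNoise d mode s φ := by
  cases mode with
  | pureDP =>
    simp only [matrixNoise]
    refine Measurable.ite (measurableSet_singleton 0) measurable_const ?_
    exact measurable_sphericalLaplace.comp (by fun_prop)
  | zCDP =>
    simp only [matrixNoise]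
    -- Noise of scale s is s times a fixed Gaussian, also for s = 0, so the parameter moves from the
    -- measure into the map.
    have e : ∀ s : ℝ≥0, (Measure.pi fun _ : Fin d × Fin d =>
        gaussianReal 0 (s ^ 2 / (2 * φ.toNNReal)))
        = (Measure.pi fun _ : Fin d × Fin d => gaussianReal 0 (1 / (2 * φ.toNNReal))).map
            fun x i => (s : ℝ) * x i := by
      intro s
      have h1 : (gaussianReal 0 (1 / (2 * φ.toNNReal))).map ((s : ℝ) * ·)
          = gaussianReal 0 (s ^ 2 / (2 * φ.toNNReal)) := by
        rw [gaussianReal_map_const_mul, mul_zero]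
        congr 1
        rw [mul_one_div]
        rfl
      have : SigmaFinite ((gaussianReal 0 (1 / (2 * φ.toNNReal))).map ((s : ℝ) * ·)) := by
        rw [h1]; infer_instance
      rw [← h1]
      exact (Measure.pi_map_pi (μ := fun _ : Fin d × Fin d => gaussianReal 0 (1 / (2 * φ.toNNReal)))
        (f := fun _ x => (s : ℝ) * x) fun i => by fun_prop).symm
    simp_rw [e]
    refine (Measure.measurable_map _ (by fun_prop)).comp (measurable_map_param _ ?_)
    refine measurable_pi_iff.2 fun i => ?_
    simp only [Function.uncurry]
    fun_prop

theorem matrixNoise_pureDP_map_add_le {s : ℝ≥0} {φ : ℝ} (hφ : 0 < φ)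
    {v : EuclideanSpace ℝ (Fin d × Fin d)} (hv : ‖v‖ ≤ s) :
    (matrixNoise d .pureDP s φ).map (· + v)
      ≤ ENNReal.ofReal (Real.exp φ) • matrixNoise d .pureDP s φ := by
  simp only [matrixNoise]
  split_ifs with h
  · have hv0 : v = 0 := by simpa [h] using hv
    subst hv0
    simp only [add_zero, Measure.map_id']
    refine Measure.le_iff.2 fun t _ => ?_
    rw [Measure.smul_apply, smul_eq_mul]
    refine le_mul_of_one_le_left zero_le ?_
    rw [ENNReal.one_le_ofReal]
    exact Real.one_le_exp hφ.le
  · have hs : (0 : ℝ) < s := by positivity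
    refine (sphericalLaplace_map_add_le (by positivity) v).trans ?_
    gcongr
    calc φ / s * ‖v‖ ≤ φ / s * s := by gcongr
      _ = φ := by field_simp

theorem momentDom_matrixNoise_map_add (mode : Mode) {s : ℝ≥0} {φ : ℝ} (hφ : 0 < φ)
    {v : EuclideanSpace ℝ (Fin d × Fin d)} (hv : ‖v‖ ≤ s) {a q : ℝ} (haq : a.HolderConjugate q) :
    MomentDom q (ENNReal.ofReal (Real.exp (φ * (a - 1))))
      ((matrixNoise d mode s φ).map (· + v)) (matrixNoise d mode s φ) := by
  have ha : 0 < a - 1 := sub_pos.2 haq.lt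
  cases mode with
  | pureDP =>
    have := isProbabilityMeasure_matrixNoise (d := d) .pureDP s hφ
    have : IsProbabilityMeasure ((matrixNoise d .pureDP s φ).map (· + v)) :=
      Measure.isProbabilityMeasure_map (by fun_prop)
    refine (MomentDom.of_le_smul haq (matrixNoise_pureDP_map_add_le hφ hv)).mono ?_
    rw [ENNReal.ofReal_rpow_of_pos (Real.exp_pos _), ← Real.exp_mul]
    refine ENNReal.ofReal_le_ofReal (Real.exp_le_exp.2 ?_)
    gcongr
    -- Domination with constant e^φ gives the exponent φ(a - 1)/a, which is below the required φ(a -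
    -- 1) since a > 1.
    have e : 1 / q = (a - 1) / a := by
      have := haq.inv_add_inv_eq_one
      have ha0 := haq.ne_zero
      rw [one_div, eq_sub_of_add_eq' this]
      field_simp
    rw [e]
    exact div_le_self ha.le haq.lt.le
  | zCDP =>
    rcases eq_or_ne s 0 with rfl | hs
    · have hv0 : v = 0 := by simpa using hv
      subst hv0
      have := isProbabilityMeasure_matrixNoise (d := d) .zCDP 0 hφ
      simp only [add_zero, Measure.map_id']
      refine (MomentDom.refl haq _).mono ?_
      rw [ENNReal.one_le_ofReal]
      exact Real.one_le_exp (by positivity)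
    · simp only [matrixNoise]
      have hvar : s ^ 2 / (2 * φ.toNNReal) ≠ 0 := by
        have : φ.toNNReal ≠ 0 := by simpa using hφ
        positivity
      have h := (momentDom_pi_gaussian_map_add hvar haq v.ofLp).map
        (F := WithLp.toLp 2) (by fun_prop)
      rw [Measure.map_map (by fun_prop) (by fun_prop)] at h ⊢
      refine h.mono (ENNReal.ofReal_le_ofReal (Real.exp_le_exp.2 ?_))
      have hs' : (0 : ℝ) < s := by positivity
      have hn : ∑ i, v.ofLp i ^ 2 ≤ (s : ℝ) ^ 2 := by
        rw [← EuclideanSpace.real_norm_sq_eq]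
        gcongr
      push_cast
      rw [Real.coe_toNNReal _ hφ.le]
      -- The variance s²/(2φ) is calibrated so that a shift of length s costs exactly φ.
      calc (a - 1) * (∑ i, v.ofLp i ^ 2) / (2 * ((s : ℝ) ^ 2 / (2 * φ)))
          ≤ (a - 1) * (s : ℝ) ^ 2 / (2 * ((s : ℝ) ^ 2 / (2 * φ))) := by gcongr
        _ = φ * (a - 1) := by field_simp

end MatrixNoise

/-! ### Privacy of the matrix mechanism -/

section PrivSPDMat

variable {d : ℕ}

theorem measurable_clip_add_toMat {α : Type*} [MeasurableSpace α] (c : ℝ)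
    {M : α → Matrix (Fin d) (Fin d) ℝ} (hM : Measurable M) :
    Measurable (Function.uncurry fun (x : α) (η : EuclideanSpace ℝ (Fin d × Fin d)) =>
      clipEigenvalues (2 * c) (symPart (M x + toMat η)) (symPart_isHermitian _)) :=
  (measurable_clip_symPart (2 * c)).comp
    (measurable_matrix_add (hM.comp measurable_fst) (measurable_toMat.comp measurable_snd))

theorem measurable_clip_const_add_toMat (M : Matrix (Fin d) (Fin d) ℝ) (c : ℝ) :
    Measurable fun η : EuclideanSpace ℝ (Fin d × Fin d) =>
      clipEigenvalues (2 * c) (symPart (M + toMat η)) (symPart_isHermitian _) :=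
  (measurable_clip_symPart (2 * c)).comp (measurable_matrix_add measurable_const measurable_toMat)

theorem isProbabilityMeasure_privSPDMat (mode : Mode) (M : Matrix (Fin d) (Fin d) ℝ) (s : ℝ≥0)
    {φ : ℝ} (hφ : 0 < φ) (c : ℝ) : IsProbabilityMeasure (privSPDMat mode M s φ c) := by
  have := isProbabilityMeasure_matrixNoise (d := d) mode s hφ
  exact Measure.isProbabilityMeasure_map (measurable_clip_const_add_toMat M c).aemeasurable

theorem measurable_privSPDMat {α : Type*} [MeasurableSpace α] (mode : Mode)
    {M : α → Matrix (Fin d) (Fin d) ℝ} (hM : Measurable M) {s : α → ℝ≥0} (hs : Measurable s)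
    {φ : ℝ} (hφ : 0 < φ) (c : ℝ) : Measurable fun x => privSPDMat mode (M x) (s x) φ c :=
  measurable_map_kernel ((measurable_matrixNoise mode φ).comp hs)
    (fun x => isProbabilityMeasure_matrixNoise mode (s x) hφ) (measurable_clip_add_toMat c hM)

/-- Replacing M' by M amounts to translating the noise, after which both laws are images under the
same map; symmetrizing and clipping are post-processing. -/
theorem privSPDMat_eq_map_shift (mode : Mode) (M M' : Matrix (Fin d) (Fin d) ℝ) (s : ℝ≥0)
    (φ c : ℝ) : privSPDMat mode M s φ c =
      ((matrixNoise d mode s φ).map (· + (toVec M - toVec M'))).map fun η =>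
        clipEigenvalues (2 * c) (symPart (M' + toMat η)) (symPart_isHermitian _) := by
  rw [Measure.map_map (measurable_clip_const_add_toMat M' c) (by fun_prop), privSPDMat]
  congr 1
  ext1 η
  have e : M + toMat η = M' + toMat (η + (toVec M - toVec M')) := by
    ext i j
    simp only [Matrix.add_apply, toMat, toVec, Matrix.of_apply, PiLp.add_apply, PiLp.sub_apply]
    ring
  simp only [Function.comp_apply, clipEigenvalues_eq_cfc, e]

theorem privSPDMat_pureDP_le {M M' : Matrix (Fin d) (Fin d) ℝ} {s : ℝ≥0} {φ : ℝ} (hφ : 0 < φ)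
    (c : ℝ) (h : ‖toVec M - toVec M'‖ ≤ s) :
    privSPDMat .pureDP M s φ c ≤ ENNReal.ofReal (Real.exp φ) • privSPDMat .pureDP M' s φ c := by
  rw [privSPDMat_eq_map_shift .pureDP M M']
  exact map_le_smul_map (matrixNoise_pureDP_map_add_le hφ h) (measurable_clip_const_add_toMat M' c)

theorem momentDom_privSPDMat (mode : Mode) {M M' : Matrix (Fin d) (Fin d) ℝ} {s : ℝ≥0} {φ : ℝ}
    (hφ : 0 < φ) (c : ℝ) (h : ‖toVec M - toVec M'‖ ≤ s) {a q : ℝ} (haq : a.HolderConjugate q) :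
    MomentDom q (ENNReal.ofReal (Real.exp (φ * (a - 1))))
      (privSPDMat mode M s φ c) (privSPDMat mode M' s φ c) := by
  rw [privSPDMat_eq_map_shift mode M M']
  exact (momentDom_matrixNoise_map_add mode hφ h haq).map (measurable_clip_const_add_toMat M' c)

theorem norm_toVec_sub_le_of_l2Sensitivity_le {n : ℕ} {F : Database d n → Matrix (Fin d) (Fin d) ℝ}
    {s : ℝ≥0} (h : l2Sensitivity F ≤ s) {D D' : Database d n} (hD : Neighbor D D') :
    ‖toVec (F D) - toVec (F D')‖ ≤ s := by
  have h1 : ‖toVec (F D) - toVec (F D')‖ₑ ≤ s :=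
    (le_iSup₂_of_le D D' (le_iSup_of_le (f := fun _ => ‖toVec (F D) - toVec (F D')‖ₑ)
      hD le_rfl)).trans h
  rw [enorm_eq_nnnorm] at h1
  exact_mod_cast h1

end PrivSPDMat

/-! ### Determinants under rank-one updates -/

section RankOne

variable {ι : Type*} [Fintype ι] [DecidableEq ι]

theorem det_add_smul_vecMulVec {A : Matrix ι ι ℝ} (hA : IsUnit A.det) (a : ℝ) (x : ι → ℝ) :
    (A + a • Matrix.vecMulVec x x).det = A.det * (1 + a * (x ⬝ᵥ (A⁻¹ *ᵥ x))) := by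
  rw [← Matrix.smul_vecMulVec, Matrix.vecMulVec_eq Unit,
    Matrix.det_add_replicateCol_mul_replicateRow hA, Matrix.det_unique (n := Unit)]
  congr 1
  rw [Matrix.add_apply, Matrix.one_apply_eq, Matrix.mul_assoc, ← Matrix.replicateCol_mulVec,
    Matrix.replicateRow_mul_replicateCol_apply, Matrix.mulVec_smul, dotProduct_smul, smul_eq_mul]

/-- For z = (B + k)⁻¹x one has x·z = z·Bz + k‖z‖², which is nonnegative and at least k‖z‖².
Expanding ‖x - kz‖² ≥ 0 then gives k(x·z) ≤ ‖x‖² ≤ 1, with no diagonalization. -/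
theorem dotProduct_inv_mulVec_mem {B : Matrix ι ι ℝ} (hB : B.PosSemidef) {k : ℝ} (hk : 0 < k)
    {x : ι → ℝ} (hx : x ⬝ᵥ x ≤ 1) :
    0 ≤ x ⬝ᵥ ((B + k • (1 : Matrix ι ι ℝ))⁻¹ *ᵥ x) ∧
      x ⬝ᵥ ((B + k • (1 : Matrix ι ι ℝ))⁻¹ *ᵥ x) ≤ 1 / k := by
  set A := B + k • (1 : Matrix ι ι ℝ) with hAdef
  have hA : A.PosDef := Matrix.PosDef.posSemidef_add hB (Matrix.PosDef.one.smul hk)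
  set z := A⁻¹ *ᵥ x with hz
  have hAz : A *ᵥ z = x := by
    rw [hz, Matrix.mulVec_mulVec, Matrix.mul_nonsing_inv _ hA.det_pos.ne'.isUnit, Matrix.one_mulVec]
  have hBz : 0 ≤ z ⬝ᵥ (B *ᵥ z) := by simpa using hB.dotProduct_mulVec_nonneg z
  have hxz : x ⬝ᵥ z = z ⬝ᵥ (B *ᵥ z) + k * (z ⬝ᵥ z) := by
    rw [dotProduct_comm, ← hAz, hAdef, Matrix.add_mulVec, dotProduct_add, Matrix.smul_mulVec,
      Matrix.one_mulVec, dotProduct_smul, smul_eq_mul]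
  have hzz : 0 ≤ z ⬝ᵥ z := by simpa using dotProduct_star_self_nonneg z
  refine ⟨by rw [hxz]; positivity, ?_⟩
  have hsq : 0 ≤ (x - k • z) ⬝ᵥ (x - k • z) := by
    simpa using dotProduct_star_self_nonneg (x - k • z)
  simp only [sub_dotProduct, dotProduct_sub, smul_dotProduct, dotProduct_smul, smul_eq_mul,
    dotProduct_comm z x] at hsq
  rw [le_div_iff₀ hk]
  nlinarith

theorem det_le_det_add_smul_vecMulVec {B : Matrix ι ι ℝ} (hB : B.PosSemidef) {k : ℝ} (hk : 0 < k)
    {x : ι → ℝ} (hx : x ⬝ᵥ x ≤ 1) {a : ℝ} (ha : 0 ≤ a) :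
    (B + k • (1 : Matrix ι ι ℝ)).det
      ≤ (B + k • (1 : Matrix ι ι ℝ) + a • Matrix.vecMulVec x x).det := by
  have hA : (B + k • (1 : Matrix ι ι ℝ)).PosDef :=
    Matrix.PosDef.posSemidef_add hB (Matrix.PosDef.one.smul hk)
  rw [det_add_smul_vecMulVec hA.det_pos.ne'.isUnit]
  have h := mul_nonneg ha (dotProduct_inv_mulVec_mem hB hk hx).1
  exact le_mul_of_one_le_right hA.det_pos.le (by linarith)

theorem det_add_smul_vecMulVec_le {B : Matrix ι ι ℝ} (hB : B.PosSemidef) {k : ℝ} (hk : 0 < k)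
    {x : ι → ℝ} (hx : x ⬝ᵥ x ≤ 1) {a t : ℝ} (ha : 0 ≤ a) (hat : a ≤ t) :
    (B + k • (1 : Matrix ι ι ℝ) + a • Matrix.vecMulVec x x).det
      ≤ (1 + t / k) * (B + k • (1 : Matrix ι ι ℝ)).det := by
  have hA : (B + k • (1 : Matrix ι ι ℝ)).PosDef :=
    Matrix.PosDef.posSemidef_add hB (Matrix.PosDef.one.smul hk)
  obtain ⟨h0, h1⟩ := dotProduct_inv_mulVec_mem hB hk hx
  rw [det_add_smul_vecMulVec hA.det_pos.ne'.isUnit, mul_comm]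
  refine mul_le_mul_of_nonneg_right ?_ hA.det_pos.le
  have : a * (x ⬝ᵥ ((B + k • (1 : Matrix ι ι ℝ))⁻¹ *ᵥ x)) ≤ t * (1 / k) :=
    mul_le_mul hat h1 h0 (ha.trans hat)
  rw [mul_one_div] at this
  linarith

end RankOne

/-! ### Density and privacy of objective perturbation -/

section ObjectivePerturbation

variable {d n : ℕ}

/-- The gradient of the loss of a record. -/
noncomputable def lossGrad (f : ℝ → ℝ) (r : Record d) (θ : EuclideanSpace ℝ (Fin d)) :
    EuclideanSpace ℝ (Fin d) :=
  (deriv f (r.y * inner ℝ θ r.x) * r.y) • r.x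

/-- The noise vector for which `θ` is the critical point of the perturbed objective. -/
noncomputable def critNoise (f : ℝ → ℝ) (c : ℝ) (D : Database d n)
    (θ : EuclideanSpace ℝ (Fin d)) : EuclideanSpace ℝ (Fin d) :=
  -(∑ i, lossGrad f (D i) θ + (2 * n * c) • θ)

/-- The matrix of the differential of `-critNoise`. -/
noncomputable def critMat (f : ℝ → ℝ) (c : ℝ) (D : Database d n)
    (θ : EuclideanSpace ℝ (Fin d)) : Matrix (Fin d) (Fin d) ℝ :=
  ∑ i, deriv (deriv f) ((D i).y * inner ℝ θ (D i).x) •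
    Matrix.vecMulVec (D i).x.ofLp (D i).x.ofLp + (2 * n * c) • (1 : Matrix (Fin d) (Fin d) ℝ)

/-- The differential of `critNoise`. -/
noncomputable def critDeriv (f : ℝ → ℝ) (c : ℝ) (D : Database d n)
    (θ : EuclideanSpace ℝ (Fin d)) : EuclideanSpace ℝ (Fin d) →L[ℝ] EuclideanSpace ℝ (Fin d) :=
  -(∑ i, deriv (deriv f) ((D i).y * inner ℝ θ (D i).x) •
    (innerSL ℝ (D i).x).smulRight (D i).x + (2 * n * c) • ContinuousLinearMap.id ℝ _)

theorem Record.y_mul_self (r : Record d) : r.y * r.y = 1 := by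
  rcases r.y_mem with h | h <;> simp [h]

theorem Record.abs_y (r : Record d) : |r.y| = 1 := by
  rcases r.y_mem with h | h <;> simp [h]

theorem Record.dotProduct_self_le (r : Record d) : r.x.ofLp ⬝ᵥ r.x.ofLp ≤ 1 := by
  have h : r.x.ofLp ⬝ᵥ r.x.ofLp = ‖r.x‖ ^ 2 := by
    rw [EuclideanSpace.real_norm_sq_eq, dotProduct]
    exact Finset.sum_congr rfl fun i _ => (sq _).symm
  rw [h]
  exact pow_le_one₀ (norm_nonneg _) r.norm_x_le

theorem hasFDerivAt_margin (r : Record d) (θ : EuclideanSpace ℝ (Fin d)) :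
    HasFDerivAt (fun θ => r.y * inner ℝ θ r.x) (r.y • innerSL ℝ r.x) θ := by
  have h := ((innerSL ℝ r.x).hasFDerivAt (x := θ)).const_mul r.y
  simpa [real_inner_comm] using h

theorem hasFDerivAt_lossGrad {f : ℝ → ℝ} (hf' : Differentiable ℝ (deriv f)) (r : Record d)
    (θ : EuclideanSpace ℝ (Fin d)) :
    HasFDerivAt (lossGrad f r)
      (deriv (deriv f) (r.y * inner ℝ θ r.x) • (innerSL ℝ r.x).smulRight r.x) θ := by
  have h1 := (hf' (r.y * inner ℝ θ r.x)).hasDerivAt.comp_hasFDerivAt θ (hasFDerivAt_margin r θ)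
  have h2 := (h1.mul_const r.y).smul_const r.x
  refine h2.congr_fderiv ?_
  ext1 v
  simp only [ContinuousLinearMap.smulRight_apply, _root_.smul_apply, smul_eq_mul,
    innerSL_apply_apply, smul_smul]
  congr 1
  linear_combination (deriv (deriv f) (r.y * inner ℝ θ r.x) * inner ℝ r.x v) * r.y_mul_self

theorem hasFDerivAt_critNoise {f : ℝ → ℝ} (hf' : Differentiable ℝ (deriv f)) (c : ℝ)
    (D : Database d n) (θ : EuclideanSpace ℝ (Fin d)) :
    HasFDerivAt (critNoise f c D) (critDeriv f c D θ) θ :=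
  ((HasFDerivAt.fun_sum fun i _ => hasFDerivAt_lossGrad hf' (D i) θ).add
    ((hasFDerivAt_id θ).const_smul (2 * n * c : ℝ))).neg

theorem abs_det_critDeriv (f : ℝ → ℝ) (c : ℝ) (D : Database d n) (θ : EuclideanSpace ℝ (Fin d)) :
    |(critDeriv f c D θ).det| = |(critMat f c D θ).det| := by
  have h : LinearMap.toMatrix (EuclideanSpace.basisFun (Fin d) ℝ).toBasis
      (EuclideanSpace.basisFun (Fin d) ℝ).toBasis (critDeriv f c D θ : _ →ₗ[ℝ] _)
      = -critMat f c D θ := by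
    ext i j
    rw [LinearMap.toMatrix_apply]
    have hin : ∀ k, inner ℝ (D k).x (EuclideanSpace.single j 1) = (D k).x.ofLp j := fun k => by
      simp [EuclideanSpace.inner_single_right]
    simp [critDeriv, critMat, Matrix.sum_apply, Matrix.vecMulVec_apply, Matrix.one_apply, hin,
      mul_comm, mul_left_comm]
  rw [ContinuousLinearMap.det,
    ← LinearMap.det_toMatrix (EuclideanSpace.basisFun (Fin d) ℝ).toBasis, h, Matrix.det_neg,
    abs_mul]
  simp

theorem norm_lossGrad_le {f : ℝ → ℝ} (hf1 : ∀ z, |deriv f z| ≤ 1) (r : Record d)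
    (θ : EuclideanSpace ℝ (Fin d)) : ‖lossGrad f r θ‖ ≤ 1 := by
  rw [lossGrad, norm_smul, Real.norm_eq_abs, abs_mul, r.abs_y, mul_one]
  exact mul_le_one₀ (hf1 _) (norm_nonneg _) r.norm_x_le

theorem inner_lossGrad_sub_nonneg {f : ℝ → ℝ} (hm : Monotone (deriv f)) (r : Record d)
    (θ θ' : EuclideanSpace ℝ (Fin d)) :
    0 ≤ inner ℝ (lossGrad f r θ - lossGrad f r θ') (θ - θ') := by
  have e : inner ℝ (lossGrad f r θ - lossGrad f r θ') (θ - θ')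
      = (deriv f (r.y * inner ℝ θ r.x) - deriv f (r.y * inner ℝ θ' r.x))
        * (r.y * inner ℝ θ r.x - r.y * inner ℝ θ' r.x) := by
    simp only [lossGrad, inner_sub_left, inner_sub_right, real_inner_smul_left,
      real_inner_comm r.x]
    ring
  rw [e]
  rcases le_total (r.y * inner ℝ θ r.x) (r.y * inner ℝ θ' r.x) with h | h
  · exact mul_nonneg_of_nonpos_of_nonpos (sub_nonpos.2 (hm h)) (sub_nonpos.2 h)
  · exact mul_nonneg (sub_nonneg.2 (hm h)) (sub_nonneg.2 h)

/-- The negative of `critNoise` is strongly monotone with constant 2nc: convexity makes the loss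
gradients monotone and the regularizer adds 2nc times the identity. -/
theorem critNoise_injective {f : ℝ → ℝ} (hm : Monotone (deriv f)) {c : ℝ} (hn : 0 < n)
    (hc : 0 < c) (D : Database d n) : Function.Injective (critNoise f c D) := by
  intro θ θ' h
  have hk : (0 : ℝ) < 2 * n * c := by positivity
  have h1 : ∑ i, (lossGrad f (D i) θ - lossGrad f (D i) θ') + (2 * n * c : ℝ) • (θ - θ') = 0 := by
    have h' := neg_injective h
    rw [Finset.sum_sub_distrib, smul_sub]
    rw [← sub_eq_zero] at h'
    rw [← h']
    abel
  have h2 : inner ℝ (∑ i, (lossGrad f (D i) θ - lossGrad f (D i) θ')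
      + (2 * n * c : ℝ) • (θ - θ')) (θ - θ') = 0 := by rw [h1, inner_zero_left]
  rw [inner_add_left, sum_inner, real_inner_smul_left, real_inner_self_eq_norm_sq] at h2
  have h3 : 0 ≤ ∑ i, inner ℝ (lossGrad f (D i) θ - lossGrad f (D i) θ') (θ - θ') :=
    Finset.sum_nonneg fun i _ => inner_lossGrad_sub_nonneg hm (D i) θ θ'
  have h4 : ‖θ - θ'‖ ^ 2 = 0 := by
    have := sq_nonneg ‖θ - θ'‖
    nlinarith
  exact sub_eq_zero.1 (norm_eq_zero.1 (pow_eq_zero_iff two_ne_zero |>.1 h4))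

theorem hasFDerivAt_objective {f : ℝ → ℝ} (hf : Differentiable ℝ f) (c : ℝ) (D : Database d n)
    (β θ : EuclideanSpace ℝ (Fin d)) :
    HasFDerivAt (objective f c D β) ((1 / n : ℝ) • innerSL ℝ (β - critNoise f c D θ)) θ := by
  have hl : ∀ i, HasFDerivAt (loss f (D i)) (innerSL ℝ (lossGrad f (D i) θ)) θ := fun i => by
    refine ((hf _).hasDerivAt.comp_hasFDerivAt θ (hasFDerivAt_margin (D i) θ)).congr_fderiv ?_
    ext1 v
    simp only [lossGrad, _root_.smul_apply, innerSL_apply_apply, smul_eq_mul,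
      real_inner_smul_left]
    ring
  have hsq := (hasStrictFDerivAt_norm_sq θ).hasFDerivAt.const_mul c
  have hβ : HasFDerivAt (fun θ => inner ℝ β θ) (innerSL ℝ β) θ := (innerSL ℝ β).hasFDerivAt
  have h := ((HasFDerivAt.fun_sum fun i (_ : i ∈ Finset.univ) => (hl i).add hsq).const_mul
    (1 / n : ℝ)).add (hβ.const_mul (1 / n : ℝ))
  refine h.congr_fderiv ?_
  ext1 v
  simp only [critNoise, Finset.sum_add_distrib, Finset.sum_const, Finset.card_univ,
    Fintype.card_fin, _root_.add_apply, _root_.smul_apply,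
    _root_.sum_apply, innerSL_apply_apply, smul_eq_mul, nsmul_eq_mul,
    inner_sub_left, inner_neg_left, inner_add_left, sum_inner, real_inner_smul_left]
  push_cast
  ring

/-- Coercivity: since |f'| ≤ 1 the loss falls at most linearly, as does the noise term, and the
quadratic regularizer dominates. -/
theorem exists_forall_objective_le {f : ℝ → ℝ} (hf : Differentiable ℝ f)
    (hf1 : ∀ z, |deriv f z| ≤ 1) {c : ℝ} (hn : 0 < n) (hc : 0 < c) (D : Database d n)
    (β : EuclideanSpace ℝ (Fin d)) : ∃ θ, ∀ θ', objective f c D β θ ≤ objective f c D β θ' := by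
  have hn' : (0 : ℝ) < n := by exact_mod_cast hn
  have hcont : Continuous (objective f c D β) := continuous_iff_continuousAt.2 fun θ =>
    (hasFDerivAt_objective hf c D β θ).continuousAt
  refine hcont.exists_forall_le ?_
  have hlip : ∀ z, f 0 - |z| ≤ f z := fun z => by
    have h := convex_univ.norm_image_sub_le_of_norm_deriv_le (f := f) (C := 1) (x := 0) (y := z)
      (fun x _ => hf x) (fun x _ => hf1 x) (Set.mem_univ _) (Set.mem_univ _)
    rw [Real.norm_eq_abs, Real.norm_eq_abs, sub_zero, one_mul] at h
    linarith [(abs_le.1 h).1]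
  have hlow : ∀ θ, f 0 + ‖θ‖ * (c * ‖θ‖ - (1 + ‖β‖ / n)) ≤ objective f c D β θ := fun θ => by
    have h1 : ∀ i, f 0 - ‖θ‖ + c * ‖θ‖ ^ 2 ≤ loss f (D i) θ + c * ‖θ‖ ^ 2 := fun i => by
      have h := hlip ((D i).y * inner ℝ θ (D i).x)
      have h' : |(D i).y * inner ℝ θ (D i).x| ≤ ‖θ‖ := by
        rw [abs_mul, (D i).abs_y, one_mul]
        exact (abs_real_inner_le_norm _ _).trans
          (mul_le_of_le_one_right (norm_nonneg _) (D i).norm_x_le)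
      rw [loss]
      linarith
    have h2 : (n : ℝ) * (f 0 - ‖θ‖ + c * ‖θ‖ ^ 2) ≤ ∑ i, (loss f (D i) θ + c * ‖θ‖ ^ 2) := by
      have h := Finset.sum_le_sum fun i (_ : i ∈ Finset.univ) => h1 i
      rwa [Finset.sum_const, Finset.card_univ, Fintype.card_fin, nsmul_eq_mul] at h
    have h3 : -(‖β‖ * ‖θ‖) ≤ inner ℝ β θ := (abs_le.1 (abs_real_inner_le_norm β θ)).1
    calc f 0 + ‖θ‖ * (c * ‖θ‖ - (1 + ‖β‖ / n))
        = (1 / n : ℝ) * (n * (f 0 - ‖θ‖ + c * ‖θ‖ ^ 2)) + (1 / n : ℝ) * -(‖β‖ * ‖θ‖) := by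
          field_simp; ring
      _ ≤ objective f c D β θ := by rw [objective]; gcongr
  refine Filter.tendsto_atTop_mono hlow (Filter.tendsto_atTop_add_const_left _ _ ?_)
  have hnorm := tendsto_norm_cocompact_atTop (E := EuclideanSpace ℝ (Fin d))
  refine hnorm.atTop_mul_atTop₀ ?_
  simp_rw [sub_eq_add_neg]
  exact Filter.tendsto_atTop_add_const_right _ _ (hnorm.const_mul_atTop hc)

theorem critNoise_argmin {f : ℝ → ℝ} (hf : Differentiable ℝ f)
    (hf1 : ∀ z, |deriv f z| ≤ 1) {c : ℝ} (hn : 0 < n) (hc : 0 < c) (D : Database d n)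
    (β : EuclideanSpace ℝ (Fin d)) : critNoise f c D (argmin (objective f c D β)) = β := by
  have hmin : ∀ θ', objective f c D β (argmin (objective f c D β)) ≤ objective f c D β θ' :=
    Classical.epsilon_spec (exists_forall_objective_le hf hf1 hn hc D β)
  have hloc : IsLocalMin (objective f c D β) (argmin (objective f c D β)) :=
    Filter.Eventually.of_forall hmin
  have h0 := hloc.hasFDerivAt_eq_zero (hasFDerivAt_objective hf c D β _)
  have hn' : (1 / n : ℝ) ≠ 0 := by positivity
  have h1 := (smul_eq_zero.1 h0).resolve_left hn'
  have h2 := congrArg (fun L => L (β - critNoise f c D (argmin (objective f c D β)))) h1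
  simp only [innerSL_apply_apply, _root_.zero_apply, inner_self_eq_zero] at h2
  exact (sub_eq_zero.1 h2).symm

theorem argmin_critNoise {f : ℝ → ℝ} (hf : Differentiable ℝ f) (hm : Monotone (deriv f))
    (hf1 : ∀ z, |deriv f z| ≤ 1) {c : ℝ} (hn : 0 < n) (hc : 0 < c) (D : Database d n)
    (θ : EuclideanSpace ℝ (Fin d)) : argmin (objective f c D (critNoise f c D θ)) = θ :=
  critNoise_injective hm hn hc D (critNoise_argmin hf hf1 hn hc D _)

theorem argmin_preimage_eq_image {f : ℝ → ℝ} (hf : Differentiable ℝ f) (hm : Monotone (deriv f))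
    (hf1 : ∀ z, |deriv f z| ≤ 1) {c : ℝ} (hn : 0 < n) (hc : 0 < c) (D : Database d n)
    (s : Set (EuclideanSpace ℝ (Fin d))) :
    (fun β => argmin (objective f c D β)) ⁻¹' s = critNoise f c D '' s :=
  (congrFun (Set.image_eq_preimage_of_inverse (g := fun β => argmin (objective f c D β))
    (argmin_critNoise hf hm hf1 hn hc D) (critNoise_argmin hf hf1 hn hc D)) s).symm

/-- Preimages under the minimization map are images under its inverse `critNoise`, and injective
differentiable maps send measurable sets to measurable sets. -/
theorem measurable_argmin_objective {f : ℝ → ℝ} (hf : Differentiable ℝ f)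
    (hf' : Differentiable ℝ (deriv f)) (hm : Monotone (deriv f)) (hf1 : ∀ z, |deriv f z| ≤ 1)
    {c : ℝ} (hn : 0 < n) (hc : 0 < c) (D : Database d n) :
    Measurable fun β => argmin (objective f c D β) := by
  intro s hs
  rw [argmin_preimage_eq_image hf hm hf1 hn hc]
  exact measurable_image_of_fderivWithin hs
    (fun θ _ => (hasFDerivAt_critNoise hf' c D θ).hasFDerivWithinAt)
    (critNoise_injective hm hn hc D).injOn

/-- The density of the output of objective perturbation, up to normalization. -/
noncomputable def perturbDensity (f : ℝ → ℝ) (c γ : ℝ) (D : Database d n)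
    (θ : EuclideanSpace ℝ (Fin d)) : ℝ :=
  |(critMat f c D θ).det| * Real.exp (-γ * ‖critNoise f c D θ‖)

theorem measurable_perturbDensity {f : ℝ → ℝ} (hf' : Differentiable ℝ (deriv f)) (c γ : ℝ)
    (D : Database d n) : Measurable (perturbDensity f c γ D) := by
  have h1 : Measurable (critNoise f c D) := (continuous_iff_continuousAt.2 fun θ =>
    (hasFDerivAt_critNoise hf' c D θ).continuousAt).measurable
  have h2 : Measurable (critMat f c D) := by
    rw [measurable_matrix_iff]
    intro i j
    simp only [critMat, Matrix.add_apply, Matrix.sum_apply, Matrix.smul_apply, smul_eq_mul]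
    have hd : ∀ k, Measurable fun θ : EuclideanSpace ℝ (Fin d) =>
        deriv (deriv f) ((D k).y * inner ℝ θ (D k).x) := fun k =>
      (measurable_deriv _).comp (by fun_prop)
    fun_prop
  have h3 : Measurable fun θ => (critMat f c D θ).det :=
    (Continuous.matrix_det continuous_id).measurable.comp h2
  unfold perturbDensity
  exact (measurable_norm.comp h3).mul (by fun_prop)

theorem map_argmin_sphericalLaplace {f : ℝ → ℝ} (hf : Differentiable ℝ f)
    (hf' : Differentiable ℝ (deriv f)) (hm : Monotone (deriv f)) (hf1 : ∀ z, |deriv f z| ≤ 1)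
    {c : ℝ} (hn : 0 < n) (hc : 0 < c) (γ : ℝ) (D : Database d n) :
    (sphericalLaplace (Fin d) γ).map (fun β => argmin (objective f c D β)) =
      (∫⁻ b : EuclideanSpace ℝ (Fin d), ENNReal.ofReal (Real.exp (-γ * ‖b‖)))⁻¹ •
        volume.withDensity fun θ => ENNReal.ofReal (perturbDensity f c γ D θ) := by
  have hmeas := measurable_argmin_objective hf hf' hm hf1 hn hc D
  ext s hs
  rw [Measure.map_apply hmeas hs, sphericalLaplace, Measure.smul_apply, Measure.smul_apply,
    withDensity_apply _ (hmeas hs), withDensity_apply _ hs,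
    argmin_preimage_eq_image hf hm hf1 hn hc,
    lintegral_image_eq_lintegral_abs_det_fderiv_mul volume hs
      (fun θ _ => (hasFDerivAt_critNoise hf' c D θ).hasFDerivWithinAt)
      (critNoise_injective hm hn hc D).injOn]
  simp_rw [abs_det_critDeriv, perturbDensity, ENNReal.ofReal_mul (abs_nonneg _)]

theorem neighbor_symm {D D' : Database d n} (h : Neighbor D D') : Neighbor D' D := by
  obtain ⟨i, hi⟩ := h
  exact ⟨i, fun j hj => (hi j hj).symm⟩

theorem posDef_critMat {f : ℝ → ℝ} (hm : Monotone (deriv f)) {c : ℝ} (hn : 0 < n) (hc : 0 < c)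
    (D : Database d n) (θ : EuclideanSpace ℝ (Fin d)) : (critMat f c D θ).PosDef := by
  refine Matrix.PosDef.posSemidef_add (Matrix.posSemidef_sum _ fun i _ => ?_)
    (Matrix.PosDef.one.smul (by positivity))
  exact Matrix.PosSemidef.smul (by simpa using Matrix.posSemidef_vecMulVec_self_star (D i).x.ofLp)
    hm.deriv_nonneg

/-- Both matrices are rank-one updates of the matrix without record i. Passing through that common
matrix, removing one record does not increase the determinant and adding the other multiplies it by
at most 1 + t/(2nc). -/
theorem det_critMat_le_of_neighbor {f : ℝ → ℝ} (hm : Monotone (deriv f)) {t c : ℝ}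
    (hf2 : ∀ z, |deriv (deriv f) z| ≤ t) (hn : 0 < n) (hc : 0 < c) {D D' : Database d n}
    (h : Neighbor D D') (θ : EuclideanSpace ℝ (Fin d)) :
    (critMat f c D θ).det ≤ (1 + t / (2 * n * c)) * (critMat f c D' θ).det := by
  obtain ⟨i, hi⟩ := h
  have hk : (0 : ℝ) < 2 * n * c := by positivity
  have ht : 0 ≤ t := (abs_nonneg _).trans (hf2 0)
  set B : Matrix (Fin d) (Fin d) ℝ := ∑ j ∈ Finset.univ.erase i,
    deriv (deriv f) ((D j).y * inner ℝ θ (D j).x) •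
      Matrix.vecMulVec (D j).x.ofLp (D j).x.ofLp with hB
  have hBpos : B.PosSemidef := Matrix.posSemidef_sum _ fun j _ =>
    Matrix.PosSemidef.smul (by simpa using Matrix.posSemidef_vecMulVec_self_star (D j).x.ofLp)
      hm.deriv_nonneg
  have hB' : B = ∑ j ∈ Finset.univ.erase i, deriv (deriv f) ((D' j).y * inner ℝ θ (D' j).x) •
      Matrix.vecMulVec (D' j).x.ofLp (D' j).x.ofLp :=
    Finset.sum_congr rfl fun j hj => by rw [hi j (Finset.ne_of_mem_erase hj)]
  have e : critMat f c D θ = B + (2 * n * c) • (1 : Matrix (Fin d) (Fin d) ℝ)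
      + deriv (deriv f) ((D i).y * inner ℝ θ (D i).x) •
        Matrix.vecMulVec (D i).x.ofLp (D i).x.ofLp := by
    rw [critMat, hB, ← Finset.sum_erase_add _ _ (Finset.mem_univ i)]
    abel
  have e' : critMat f c D' θ = B + (2 * n * c) • (1 : Matrix (Fin d) (Fin d) ℝ)
      + deriv (deriv f) ((D' i).y * inner ℝ θ (D' i).x) •
        Matrix.vecMulVec (D' i).x.ofLp (D' i).x.ofLp := by
    rw [critMat, hB', ← Finset.sum_erase_add _ _ (Finset.mem_univ i)]
    abel
  rw [e, e']
  refine (det_add_smul_vecMulVec_le hBpos hk (D i).dotProduct_self_le hm.deriv_nonneg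
    ((le_abs_self _).trans (hf2 _))).trans ?_
  gcongr
  exact det_le_det_add_smul_vecMulVec hBpos hk (D' i).dotProduct_self_le hm.deriv_nonneg

theorem norm_critNoise_sub_le_of_neighbor {f : ℝ → ℝ} (hf1 : ∀ z, |deriv f z| ≤ 1) (c : ℝ)
    {D D' : Database d n} (h : Neighbor D D') (θ : EuclideanSpace ℝ (Fin d)) :
    ‖critNoise f c D' θ - critNoise f c D θ‖ ≤ 2 := by
  obtain ⟨i, hi⟩ := h
  have e : critNoise f c D' θ - critNoise f c D θ
      = lossGrad f (D i) θ - lossGrad f (D' i) θ := by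
    have hs : ∑ j ∈ Finset.univ.erase i, lossGrad f (D j) θ
        = ∑ j ∈ Finset.univ.erase i, lossGrad f (D' j) θ :=
      Finset.sum_congr rfl fun j hj => by rw [hi j (Finset.ne_of_mem_erase hj)]
    rw [critNoise, critNoise, ← Finset.sum_erase_add _ _ (Finset.mem_univ i),
      ← Finset.sum_erase_add (s := Finset.univ) (f := fun j => lossGrad f (D j) θ)
        (Finset.mem_univ i), hs]
    abel
  rw [e]
  refine (norm_sub_le _ _).trans ?_
  linarith [norm_lossGrad_le hf1 (D i) θ, norm_lossGrad_le hf1 (D' i) θ]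

theorem perturbDensity_pos {f : ℝ → ℝ} (hm : Monotone (deriv f)) {c : ℝ} (hn : 0 < n)
    (hc : 0 < c) (γ : ℝ) (D : Database d n) (θ : EuclideanSpace ℝ (Fin d)) :
    0 < perturbDensity f c γ D θ :=
  mul_pos (abs_pos.2 (posDef_critMat hm hn hc D θ).det_pos.ne') (Real.exp_pos _)

theorem perturbDensity_le_of_neighbor {f : ℝ → ℝ} (hm : Monotone (deriv f)) {φ t c : ℝ}
    (hf1 : ∀ z, |deriv f z| ≤ 1) (hf2 : ∀ z, |deriv (deriv f) z| ≤ t) (hn : 0 < n) (hc : 0 < c)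
    (hε : 0 < epsPrime n φ t c) {D D' : Database d n} (h : Neighbor D D')
    (θ : EuclideanSpace ℝ (Fin d)) :
    perturbDensity f c (epsPrime n φ t c / 2) D θ
      ≤ Real.exp φ * perturbDensity f c (epsPrime n φ t c / 2) D' θ := by
  set ε' := epsPrime n φ t c with hε'
  have ht : 0 ≤ t := (abs_nonneg _).trans (hf2 0)
  have hpos : 0 < 1 + t / (2 * n * c) := by positivity
  -- The definition of ε' splits the budget: the first factor pays for the determinants, the second
  -- for a noise shift of length 2 at rate ε'/2.
  have he : Real.exp φ = (1 + t / (2 * n * c)) * Real.exp ε' := by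
    rw [hε', epsPrime, Real.exp_sub, Real.exp_log hpos]
    field_simp
  have hdet := det_critMat_le_of_neighbor hm hf2 hn hc h θ
  have hnorm := norm_critNoise_sub_le_of_neighbor hf1 c h θ
  have hexp : Real.exp (-(ε' / 2) * ‖critNoise f c D θ‖)
      ≤ Real.exp ε' * Real.exp (-(ε' / 2) * ‖critNoise f c D' θ‖) := by
    rw [← Real.exp_add]
    refine Real.exp_le_exp.2 ?_
    have := norm_sub_norm_le (critNoise f c D' θ) (critNoise f c D θ)
    nlinarith
  rw [perturbDensity, perturbDensity, abs_of_pos (posDef_critMat hm hn hc D θ).det_pos,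
    abs_of_pos (posDef_critMat hm hn hc D' θ).det_pos, he]
  calc (critMat f c D θ).det * Real.exp (-(ε' / 2) * ‖critNoise f c D θ‖)
      ≤ ((1 + t / (2 * n * c)) * (critMat f c D' θ).det)
        * (Real.exp ε' * Real.exp (-(ε' / 2) * ‖critNoise f c D' θ‖)) := by
        refine mul_le_mul hdet hexp (Real.exp_pos _).le (mul_nonneg hpos.le ?_)
        exact (posDef_critMat hm hn hc D' θ).det_pos.le
    _ = _ := by ring

/-- The outputs of objective perturbation on neighbors have a likelihood ratio with values in
`[e^{-φ}, e^φ]`. -/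
theorem exists_objPerturb_eq_withDensity {f : ℝ → ℝ} (hf : Differentiable ℝ f)
    (hf' : Differentiable ℝ (deriv f)) (hm : Monotone (deriv f)) {φ t c : ℝ}
    (hf1 : ∀ z, |deriv f z| ≤ 1) (hf2 : ∀ z, |deriv (deriv f) z| ≤ t) (hn : 0 < n) (hc : 0 < c)
    (hε : 0 < epsPrime n φ t c) {D D' : Database d n} (h : Neighbor D D') :
    ∃ Z : EuclideanSpace ℝ (Fin d) → ℝ, Measurable Z ∧ (∀ θ, Real.exp (-φ) ≤ Z θ) ∧
      (∀ θ, Z θ ≤ Real.exp φ) ∧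
      objPerturb f φ t c D = (objPerturb f φ t c D').withDensity fun θ => ENNReal.ofReal (Z θ) := by
  set γ := epsPrime n φ t c / 2 with hγ
  have hpos := perturbDensity_pos hm hn hc γ D
  have hpos' := perturbDensity_pos hm hn hc γ D'
  have hmD := measurable_perturbDensity hf' c γ D
  have hmD' := measurable_perturbDensity hf' c γ D'
  have hmZ : Measurable fun θ => perturbDensity f c γ D θ / perturbDensity f c γ D' θ :=
    hmD.div hmD'
  refine ⟨fun θ => perturbDensity f c γ D θ / perturbDensity f c γ D' θ, hmZ,
    fun θ => ?_, fun θ => ?_, ?_⟩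
  -- The lower bound is the upper bound with the two databases exchanged.
  · rw [le_div_iff₀ (hpos' θ), Real.exp_neg, inv_mul_le_iff₀ (Real.exp_pos _)]
    exact perturbDensity_le_of_neighbor hm hf1 hf2 hn hc hε (neighbor_symm h) θ
  · rw [div_le_iff₀ (hpos' θ)]
    exact perturbDensity_le_of_neighbor hm hf1 hf2 hn hc hε h θ
  · rw [objPerturb, objPerturb, map_argmin_sphericalLaplace hf hf' hm hf1 hn hc,
      map_argmin_sphericalLaplace hf hf' hm hf1 hn hc, withDensity_smul_measure,
      ← hγ,
      ← withDensity_mul _ hmD'.ennreal_ofReal hmZ.ennreal_ofReal]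
    congr 2
    ext1 θ
    rw [Pi.mul_apply, ← ENNReal.ofReal_mul (hpos' θ).le, mul_div_cancel₀ _ (hpos' θ).ne']

theorem isProbabilityMeasure_objPerturb {f : ℝ → ℝ} (hf : Differentiable ℝ f)
    (hf' : Differentiable ℝ (deriv f)) (hm : Monotone (deriv f)) {φ t c : ℝ}
    (hf1 : ∀ z, |deriv f z| ≤ 1) (hn : 0 < n) (hc : 0 < c) (hε : 0 < epsPrime n φ t c)
    (D : Database d n) : IsProbabilityMeasure (objPerturb f φ t c D) := by
  have := isProbabilityMeasure_sphericalLaplace (ι := Fin d) (half_pos hε)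
  exact Measure.isProbabilityMeasure_map
    (measurable_argmin_objective hf hf' hm hf1 hn hc D).aemeasurable

theorem objPerturb_le_of_neighbor {f : ℝ → ℝ} (hf : Differentiable ℝ f)
    (hf' : Differentiable ℝ (deriv f)) (hm : Monotone (deriv f)) {φ t c : ℝ}
    (hf1 : ∀ z, |deriv f z| ≤ 1) (hf2 : ∀ z, |deriv (deriv f) z| ≤ t) (hn : 0 < n) (hc : 0 < c)
    (hε : 0 < epsPrime n φ t c) {D D' : Database d n} (h : Neighbor D D') :
    objPerturb f φ t c D ≤ ENNReal.ofReal (Real.exp φ) • objPerturb f φ t c D' := by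
  obtain ⟨Z, -, -, hr, hZ⟩ := exists_objPerturb_eq_withDensity hf hf' hm hf1 hf2 hn hc hε h
  rw [hZ, ← withDensity_const]
  exact withDensity_mono (ae_of_all _ fun θ => ENNReal.ofReal_le_ofReal (hr θ))

theorem momentDom_objPerturb {f : ℝ → ℝ} (hf : Differentiable ℝ f)
    (hf' : Differentiable ℝ (deriv f)) (hm : Monotone (deriv f)) {φ t c : ℝ} (hφ : 0 < φ)
    (hf1 : ∀ z, |deriv f z| ≤ 1) (hf2 : ∀ z, |deriv (deriv f) z| ≤ t) (hn : 0 < n) (hc : 0 < c)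
    (hε : 0 < epsPrime n φ t c) {D D' : Database d n} (h : Neighbor D D') {a q : ℝ}
    (haq : a.HolderConjugate q) :
    MomentDom q (ENNReal.ofReal (Real.exp (φ ^ 2 / 2 * (a - 1))))
      (objPerturb f φ t c D) (objPerturb f φ t c D') := by
  obtain ⟨Z, hZm, hl, hr, hZ⟩ := exists_objPerturb_eq_withDensity hf hf' hm hf1 hf2 hn hc hε h
  have := isProbabilityMeasure_objPerturb hf hf' hm hf1 hn hc hε D'
  have hone : ∫⁻ θ, ENNReal.ofReal (Z θ) ∂objPerturb f φ t c D' = 1 := by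
    have h1 := (isProbabilityMeasure_objPerturb hf hf' hm hf1 hn hc hε D).measure_univ
    rwa [hZ, withDensity_apply _ MeasurableSet.univ, Measure.restrict_univ] at h1
  have hmom := lintegral_rpow_le_of_ratio_mem hZm haq.lt hφ hl hr hone
  rw [hZ]
  refine (momentDom_withDensity haq _ hZm.ennreal_ofReal).mono ?_
  refine (ENNReal.rpow_le_rpow hmom (one_div_nonneg.2 haq.nonneg)).trans (le_of_eq ?_)
  rw [ENNReal.ofReal_rpow_of_pos (Real.exp_pos _), ← Real.exp_mul]
  congr 2
  have := haq.ne_zero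
  field_simp

end ObjectivePerturbation

/-! ### Measurability of the matrices and of the post-processing -/

section ConfidenceIntervals

variable {d n m : ℕ}

theorem measurable_hessianMat (f : ℝ → ℝ) (c : ℝ) (D : Database d n) :
    Measurable fun θ => hessianMat f c θ D := by
  rw [measurable_matrix_iff]
  intro i j
  simp only [hessianMat, hessian, Matrix.add_apply, Matrix.smul_apply, Matrix.sum_apply,
    Matrix.of_apply, smul_eq_mul]
  refine ((Finset.measurable_fun_sum _ fun k _ => ?_).const_mul _).add_const _
  -- The second derivative of f need not be continuous; derivatives are measurable regardless.
  exact measurable_fderiv_apply_const ℝ _ _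

theorem measurable_gradient (g : EuclideanSpace ℝ (Fin d) → ℝ) : Measurable (gradient g) :=
  ((InnerProductSpace.toDual ℝ (EuclideanSpace ℝ (Fin d))).symm.continuous.measurable).comp
    (measurable_fderiv ℝ g)

theorem measurable_covMat (f : ℝ → ℝ) (c : ℝ) (D : Database d n) :
    Measurable fun θ => covMat f c θ D := by
  rw [measurable_matrix_iff]
  intro i j
  have hg : ∀ k l, Measurable fun θ => gradient (loss f (D k)) θ l := fun k l =>
    (measurable_pi_apply l).comp
      ((WithLp.measurable_ofLp 2 _).comp (measurable_gradient (loss f (D k))))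
  simp only [covMat, Matrix.sub_apply, Matrix.smul_apply, Matrix.sum_apply,
    Matrix.vecMulVec_apply, smul_eq_mul]
  have hθ : ∀ l, Measurable fun θ : EuclideanSpace ℝ (Fin d) => θ l := fun l => by fun_prop
  exact ((Finset.measurable_fun_sum _ fun k _ => (hg k i).mul (hg k j)).const_mul _).sub
    (((hθ i).mul (hθ j)).const_mul _)

/-- The law of the output of the post-processing step, given the released parameter and
matrices. -/
noncomputable def postProcess (n : ℕ) (γ : ℝ) (ci : (Fin m → ℝ) → ℝ × ℝ)
    (p : EuclideanSpace ℝ (Fin d) × Matrix (Fin d) (Fin d) ℝ × Matrix (Fin d) (Fin d) ℝ) :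
    Measure ((Fin d → ℝ) × (Fin d → ℝ)) :=
  (Measure.pi fun _ : Fin m => multivariateGaussian 0 p.2.2).bind fun G =>
  (Measure.pi fun _ : Fin m => sphericalLaplace (Fin d) γ).map fun B =>
    (fun j => (ci fun i => resample n p.1 p.2.1 (G i) (B i) j).1,
     fun j => (ci fun i => resample n p.1 p.2.1 (G i) (B i) j).2)

open scoped MatrixOrder in
theorem measurable_pi_multivariateGaussian :
    Measurable fun S : Matrix (Fin d) (Fin d) ℝ =>
      Measure.pi fun _ : Fin m => multivariateGaussian 0 S := by
  -- Writing the law as the image of standard Gaussians under √S reduces the claim to measurability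
  -- of the matrix square root.
  have e : ∀ S : Matrix (Fin d) (Fin d) ℝ,
      (Measure.pi fun _ : Fin m => multivariateGaussian 0 S)
      = (Measure.pi fun _ : Fin m => stdGaussian (EuclideanSpace ℝ (Fin d))).map fun x i =>
          0 + Matrix.toEuclideanCLM (𝕜 := ℝ) (CFC.sqrt S) (x i) := by
    intro S
    have : SigmaFinite ((stdGaussian (EuclideanSpace ℝ (Fin d))).map fun x =>
        0 + Matrix.toEuclideanCLM (𝕜 := ℝ) (CFC.sqrt S) x) :=
      inferInstanceAs (SigmaFinite (multivariateGaussian 0 S))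
    exact (Measure.pi_map_pi (μ := fun _ : Fin m => stdGaussian (EuclideanSpace ℝ (Fin d)))
      (f := fun _ x => 0 + Matrix.toEuclideanCLM (𝕜 := ℝ) (CFC.sqrt S) x)
      fun i => by fun_prop).symm
  simp_rw [e]
  refine measurable_map_param _ (measurable_pi_iff.2 fun i => ?_)
  have h : ∀ k l, Measurable fun p : Matrix (Fin d) (Fin d) ℝ ×
      (Fin m → EuclideanSpace ℝ (Fin d)) => CFC.sqrt p.1 k l := fun k l =>
    measurable_matrix_iff.1 (measurable_cfc_sqrt.comp measurable_fst) k l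
  have hcoord : ∀ l, Measurable fun p : Matrix (Fin d) (Fin d) ℝ ×
      (Fin m → EuclideanSpace ℝ (Fin d)) => p.2 i l := fun l => by fun_prop
  have hsum : Measurable fun (p : Matrix (Fin d) (Fin d) ℝ × (Fin m → EuclideanSpace ℝ (Fin d)))
      (k : Fin d) => ∑ l, CFC.sqrt p.1 k l * p.2 i l :=
    measurable_pi_iff.2 fun k => Finset.measurable_fun_sum _ fun l _ => (h k l).mul (hcoord l)
  have e' : (fun p : Matrix (Fin d) (Fin d) ℝ × (Fin m → EuclideanSpace ℝ (Fin d)) =>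
      0 + Matrix.toEuclideanCLM (𝕜 := ℝ) (CFC.sqrt p.1) (p.2 i))
      = fun p : Matrix (Fin d) (Fin d) ℝ × (Fin m → EuclideanSpace ℝ (Fin d)) =>
        WithLp.toLp 2 fun k => ∑ l, CFC.sqrt p.1 k l * p.2 i l := by
    ext p k
    rw [zero_add]
    rfl
  exact e' ▸ (WithLp.measurable_toLp 2 _).comp hsum

theorem measurable_resample_apply {α : Type*} [MeasurableSpace α] (n : ℕ)
    {θ G β : α → EuclideanSpace ℝ (Fin d)} {H : α → Matrix (Fin d) (Fin d) ℝ}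
    (hθ : Measurable θ) (hH : Measurable H) (hG : Measurable G) (hβ : Measurable β) (j : Fin d) :
    Measurable fun a => resample n (θ a) (H a) (G a) (β a) j := by
  have hinv : ∀ k, Measurable fun a => (H a)⁻¹ j k := fun k =>
    measurable_matrix_iff.1 (measurable_matrix_inv.comp hH) j k
  simp only [resample, PiLp.add_apply, PiLp.smul_apply, Matrix.mulVec, dotProduct, smul_eq_mul]
  have hcoord : ∀ l, Measurable fun x : EuclideanSpace ℝ (Fin d) => x l := fun l => by fun_prop
  exact ((hcoord j).comp hθ).add ((Finset.measurable_fun_sum _ fun k _ => (hinv k).mul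
    (((hcoord k).comp hG).add (((hcoord k).comp hβ).const_mul _))).const_mul _)

theorem measurable_postProcess (n : ℕ) {γ : ℝ} (hγ : 0 < γ) {ci : (Fin m → ℝ) → ℝ × ℝ}
    (hci : Measurable ci) : Measurable (postProcess (d := d) n γ ci) := by
  have := isProbabilityMeasure_sphericalLaplace (ι := Fin d) hγ
  refine measurable_bind_kernel (measurable_pi_multivariateGaussian.comp
    (measurable_snd.comp measurable_snd)) (fun p => by dsimp only [Function.comp]; infer_instance) ?_
  refine measurable_map_param (Measure.pi fun _ : Fin m => sphericalLaplace (Fin d) γ) (F :=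
    fun (p : (EuclideanSpace ℝ (Fin d) × Matrix (Fin d) (Fin d) ℝ × Matrix (Fin d) (Fin d) ℝ) ×
        (Fin m → EuclideanSpace ℝ (Fin d))) B =>
      (fun j => (ci fun i => resample n p.1.1 p.1.2.1 (p.2 i) (B i) j).1,
       fun j => (ci fun i => resample n p.1.1 p.1.2.1 (p.2 i) (B i) j).2)) ?_
  have h : ∀ j, Measurable fun q : ((EuclideanSpace ℝ (Fin d) × Matrix (Fin d) (Fin d) ℝ ×
      Matrix (Fin d) (Fin d) ℝ) × (Fin m → EuclideanSpace ℝ (Fin d))) ×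
      (Fin m → EuclideanSpace ℝ (Fin d)) =>
      ci fun i => resample n q.1.1.1 q.1.1.2.1 (q.1.2 i) (q.2 i) j := fun j =>
    hci.comp (measurable_pi_iff.2 fun i =>
      measurable_resample_apply n (by fun_prop) (by fun_prop) (by fun_prop) (by fun_prop) j)
  exact (measurable_pi_iff.2 fun j => measurable_fst.comp (h j)).prodMk
    (measurable_pi_iff.2 fun j => measurable_snd.comp (h j))

theorem isProbabilityMeasure_postProcess (n : ℕ) {γ : ℝ} (hγ : 0 < γ)
    {ci : (Fin m → ℝ) → ℝ × ℝ} (hci : Measurable ci)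
    (p : EuclideanSpace ℝ (Fin d) × Matrix (Fin d) (Fin d) ℝ × Matrix (Fin d) (Fin d) ℝ) :
    IsProbabilityMeasure (postProcess n γ ci p) := by
  have := isProbabilityMeasure_sphericalLaplace (ι := Fin d) hγ
  have h : ∀ j, Measurable fun q : (Fin m → EuclideanSpace ℝ (Fin d)) ×
      (Fin m → EuclideanSpace ℝ (Fin d)) =>
      ci fun i => resample n p.1 p.2.1 (q.1 i) (q.2 i) j := fun j =>
    hci.comp (measurable_pi_iff.2 fun i =>
      measurable_resample_apply n (by fun_prop) (by fun_prop) (by fun_prop) (by fun_prop) j)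
  have hF := (measurable_pi_iff.2 fun j => measurable_fst.comp (h j)).prodMk
    (measurable_pi_iff.2 fun j => measurable_snd.comp (h j))
  refine isProbabilityMeasure_bind (measurable_map_param
    (Measure.pi fun _ : Fin m => sphericalLaplace (Fin d) γ) hF) fun G => ?_
  exact Measure.isProbabilityMeasure_map (hF.comp measurable_prodMk_left).aemeasurable

end ConfidenceIntervals

/-! ### Composition of the three releases -/

section ThreeStage

variable {α β γ Ω : Type*} [MeasurableSpace α] [MeasurableSpace β] [MeasurableSpace γ]
  [MeasurableSpace Ω]

/-- Run `P`, then `κ` and `η` independently on its output, then `post` on all three outputs. -/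
noncomputable def threeStage (P : Measure α) (κ : α → Measure β) (η : α → Measure γ)
    (post : α × β × γ → Measure Ω) : Measure Ω :=
  P.bind fun a => (κ a).bind fun b => (η a).bind fun g => post (a, b, g)

theorem measurable_post_section {post : α × β × γ → Measure Ω} (hpost : Measurable post) (a : α)
    (b : β) : Measurable fun g => post (a, b, g) :=
  hpost.comp (measurable_const.prodMk (measurable_const.prodMk measurable_id))

theorem measurable_uncurry_lastStage {η : α → Measure γ} {post : α × β × γ → Measure Ω}
    (hη : Measurable η) (hηp : ∀ a, IsProbabilityMeasure (η a)) (hpost : Measurable post) :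
    Measurable (Function.uncurry fun a b => (η a).bind fun g => post (a, b, g)) :=
  measurable_bind_kernel (hη.comp measurable_fst) (fun p => hηp p.1)
    (η := fun (p : α × β) g => post (p.1, p.2, g))
    (hpost.comp ((measurable_fst.comp measurable_fst).prodMk
      ((measurable_snd.comp measurable_fst).prodMk measurable_snd)))

theorem measurable_lastStage {η : α → Measure γ} {post : α × β × γ → Measure Ω}
    (hη : Measurable η) (hηp : ∀ a, IsProbabilityMeasure (η a)) (hpost : Measurable post) (a : α) :
    Measurable fun b => (η a).bind fun g => post (a, b, g) :=
  (measurable_uncurry_lastStage hη hηp hpost).of_uncurry_left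

theorem measurable_middleStage {κ : α → Measure β} {η : α → Measure γ}
    {post : α × β × γ → Measure Ω} (hκ : Measurable κ) (hκp : ∀ a, IsProbabilityMeasure (κ a))
    (hη : Measurable η) (hηp : ∀ a, IsProbabilityMeasure (η a)) (hpost : Measurable post) :
    Measurable fun a => (κ a).bind fun b => (η a).bind fun g => post (a, b, g) :=
  measurable_bind_kernel hκ hκp (measurable_uncurry_lastStage hη hηp hpost)

theorem isProbabilityMeasure_threeStage {P : Measure α} [IsProbabilityMeasure P]
    {κ : α → Measure β} {η : α → Measure γ} {post : α × β × γ → Measure Ω}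
    (hκ : Measurable κ) (hκp : ∀ a, IsProbabilityMeasure (κ a))
    (hη : Measurable η) (hηp : ∀ a, IsProbabilityMeasure (η a))
    (hpost : Measurable post) (hpostp : ∀ p, IsProbabilityMeasure (post p)) :
    IsProbabilityMeasure (threeStage P κ η post) :=
  isProbabilityMeasure_bind (measurable_middleStage hκ hκp hη hηp hpost) fun a =>
    isProbabilityMeasure_bind (measurable_lastStage hη hηp hpost a) fun b =>
    isProbabilityMeasure_bind (measurable_post_section hpost a b) fun _ => hpostp _

theorem threeStage_le_smul {P P' : Measure α} {κ κ' : α → Measure β} {η η' : α → Measure γ}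
    {post : α × β × γ → Measure Ω} {K₁ K₂ K₃ : ℝ≥0∞}
    (hκ : Measurable κ) (hκp : ∀ a, IsProbabilityMeasure (κ a))
    (hκ' : Measurable κ') (hκp' : ∀ a, IsProbabilityMeasure (κ' a))
    (hη : Measurable η) (hηp : ∀ a, IsProbabilityMeasure (η a))
    (hη' : Measurable η') (hηp' : ∀ a, IsProbabilityMeasure (η' a)) (hpost : Measurable post)
    (h₁ : P ≤ K₁ • P') (h₂ : ∀ a, κ a ≤ K₂ • κ' a) (h₃ : ∀ a, η a ≤ K₃ • η' a) :
    threeStage P κ η post ≤ (K₁ * (K₂ * K₃)) • threeStage P' κ' η' post :=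
  bind_le_smul_bind h₁ (measurable_middleStage hκ hκp hη hηp hpost)
    (measurable_middleStage hκ' hκp' hη' hηp' hpost) fun a =>
  bind_le_smul_bind (h₂ a) (measurable_lastStage hη hηp hpost a)
    (measurable_lastStage hη' hηp' hpost a) fun b =>
  -- Post-processing is the same kernel on both sides, so it costs the factor one.
  (bind_le_smul_bind (K₂ := 1) (h₃ a) (measurable_post_section hpost a b)
    (measurable_post_section hpost a b) fun g => by rw [one_smul]).trans (by rw [mul_one])

theorem momentDom_threeStage {p q : ℝ} (hpq : p.HolderConjugate q) {P P' : Measure α}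
    {κ κ' : α → Measure β} {η η' : α → Measure γ} {post : α × β × γ → Measure Ω}
    {C₁ C₂ C₃ : ℝ≥0∞}
    (hκ : Measurable κ) (hκp : ∀ a, IsProbabilityMeasure (κ a))
    (hκ' : Measurable κ') (hκp' : ∀ a, IsProbabilityMeasure (κ' a))
    (hη : Measurable η) (hηp : ∀ a, IsProbabilityMeasure (η a))
    (hη' : Measurable η') (hηp' : ∀ a, IsProbabilityMeasure (η' a))
    (hpost : Measurable post) (hpostp : ∀ p, IsProbabilityMeasure (post p))
    (h₁ : MomentDom q C₁ P P') (h₂ : ∀ a, MomentDom q C₂ (κ a) (κ' a))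
    (h₃ : ∀ a, MomentDom q C₃ (η a) (η' a)) :
    MomentDom q (C₁ * (C₂ * C₃)) (threeStage P κ η post) (threeStage P' κ' η' post) :=
  h₁.bind hpq.symm.pos (measurable_middleStage hκ hκp hη hηp hpost)
    (measurable_middleStage hκ' hκp' hη' hηp' hpost) fun a =>
  (h₂ a).bind hpq.symm.pos (measurable_lastStage hη hηp hpost a)
    (measurable_lastStage hη' hηp' hpost a) fun b =>
  ((h₃ a).bind hpq.symm.pos (measurable_post_section hpost a b)
    (measurable_post_section hpost a b) fun g =>
      have := hpostp (a, b, g)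
      MomentDom.refl hpq (post (a, b, g))).mono (by rw [mul_one])

end ThreeStage

theorem confidenceIntervals_eq_threeStage {d n m : ℕ} (mode : Mode) (f : ℝ → ℝ)
    (t c φ₁ φ₂ φ₃ : ℝ) (sH sC : EuclideanSpace ℝ (Fin d) → ℝ≥0) (ci : (Fin m → ℝ) → ℝ × ℝ)
    (D : Database d n) :
    confidenceIntervals mode f t c φ₁ φ₂ φ₃ sH sC ci D =
      threeStage (objPerturb f φ₁ t c D)
        (fun θ => privSPDMat mode (hessianMat f c θ D) (sH θ) φ₂ c)
        (fun θ => privSPDMat mode (covMat f c θ D) (sC θ) φ₃ c)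
        (postProcess n (epsPrime n φ₁ t c / 2) ci) :=
  rfl

/-- The lower bound on c says t/(2nc) < e^φ - 1, so the logarithm subtracted in ε' is below φ. -/
theorem epsPrime_pos {n : ℕ} (hn : 0 < n) {t φ c : ℝ} (ht : 0 ≤ t) (hφ : 0 < φ) (hc0 : 0 < c)
    (hc : t / (2 * n * (Real.exp φ - 1)) < c) : 0 < epsPrime n φ t c := by
  have hn' : (0 : ℝ) < n := by exact_mod_cast hn
  have hexp : 0 < Real.exp φ - 1 := sub_pos.2 (Real.one_lt_exp_iff.2 hφ)
  rw [epsPrime, sub_pos, Real.log_lt_iff_lt_exp (by positivity)]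
  rw [div_lt_iff₀ (by positivity)] at hc
  have : t / (2 * n * c) < Real.exp φ - 1 := by
    rw [div_lt_iff₀ (by positivity)]
    linarith
  linarith

end PrivCI

open PrivCI in
theorem theorem2 {d n m : ℕ} (hn : 0 < n)
    (f : ℝ → ℝ) (hconv : ConvexOn ℝ Set.univ f)
    (hf : Differentiable ℝ f) (hf' : Differentiable ℝ (deriv f))
    (t : ℝ) (hf1 : ∀ z, |deriv f z| ≤ 1) (hf2 : ∀ z, |deriv (deriv f) z| ≤ t)
    (φ₁ φ₂ φ₃ : ℝ) (hφ₁ : 0 < φ₁) (hφ₂ : 0 < φ₂) (hφ₃ : 0 < φ₃)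
    (c : ℝ) (hc : t / (2 * n * (Real.exp φ₁ - 1)) < c)
    (α : ℝ) (ci : (Fin m → ℝ) → ℝ × ℝ) (hci : PrivCI.IsIntervalRule α ci)
    (sH sC : EuclideanSpace ℝ (Fin d) → NNReal) (hsH : Measurable sH) (hsC : Measurable sC)
    (hH : ∀ θ, PrivCI.l2Sensitivity (n := n) (PrivCI.hessianMat f c θ) ≤ sH θ)
    (hC : ∀ θ, PrivCI.l2Sensitivity (n := n) (PrivCI.covMat f c θ) ≤ sC θ) :
    PrivCI.IsDP (n := n) (φ₁ + φ₂ + φ₃)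
      (PrivCI.confidenceIntervals .pureDP f t c φ₁ φ₂ φ₃ sH sC ci) ∧
    ∀ mode : PrivCI.Mode, PrivCI.IsZCDP (n := n) (φ₁ ^ 2 / 2 + φ₂ + φ₃)
      (PrivCI.confidenceIntervals mode f t c φ₁ φ₂ φ₃ sH sC ci) := by
  have hm : Monotone (deriv f) := monotoneOn_univ.1 (hconv.monotoneOn_deriv fun x _ => hf x)
  have ht : 0 ≤ t := (abs_nonneg _).trans (hf2 0)
  have hexp : 0 < Real.exp φ₁ - 1 := sub_pos.2 (Real.one_lt_exp_iff.2 hφ₁)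
  -- Positivity of c follows from its lower bound, which is nonnegative because t bounds an absolute
  -- value.
  have hc0 : 0 < c := lt_of_le_of_lt
    (div_nonneg ht (mul_nonneg (mul_nonneg zero_le_two n.cast_nonneg) hexp.le)) hc
  have hε : 0 < epsPrime n φ₁ t c := epsPrime_pos hn ht hφ₁ hc0 hc
  have hpm := measurable_postProcess (d := d) n (half_pos hε) hci.measurable
  have hpp := isProbabilityMeasure_postProcess (d := d) n (half_pos hε) hci.measurable
  have hmH := fun mode (D : Database d n) =>
    measurable_privSPDMat mode (measurable_hessianMat f c D) hsH hφ₂ c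
  have hmC := fun mode (D : Database d n) =>
    measurable_privSPDMat mode (measurable_covMat f c D) hsC hφ₃ c
  have hpH := fun mode (D : Database d n) θ =>
    isProbabilityMeasure_privSPDMat mode (hessianMat f c θ D) (sH θ) hφ₂ c
  have hpC := fun mode (D : Database d n) θ =>
    isProbabilityMeasure_privSPDMat mode (covMat f c θ D) (sC θ) hφ₃ c
  have hpO := isProbabilityMeasure_objPerturb (d := d) (φ := φ₁) (t := t) hf hf' hm hf1 hn hc0 hε
  have hmech : ∀ mode, IsMechanism (n := n)
      (confidenceIntervals mode f t c φ₁ φ₂ φ₃ sH sC ci) := fun mode D => by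
    rw [confidenceIntervals_eq_threeStage]
    have := hpO D
    exact isProbabilityMeasure_threeStage (hmH mode D) (hpH mode D) (hmC mode D) (hpC mode D)
      hpm hpp
  refine ⟨⟨hmech _, fun D D' hD V _ => ?_⟩, fun mode => ⟨hmech mode, fun D D' hD a ha => ?_⟩⟩
  · have hle := threeStage_le_smul (hmH .pureDP D) (hpH .pureDP D) (hmH .pureDP D')
      (hpH .pureDP D') (hmC .pureDP D) (hpC .pureDP D) (hmC .pureDP D') (hpC .pureDP D') hpm
      (objPerturb_le_of_neighbor hf hf' hm hf1 hf2 hn hc0 hε hD)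
      (fun θ => privSPDMat_pureDP_le hφ₂ c (norm_toVec_sub_le_of_l2Sensitivity_le (hH θ) hD))
      (fun θ => privSPDMat_pureDP_le hφ₃ c (norm_toVec_sub_le_of_l2Sensitivity_le (hC θ) hD)) V
    rw [← ENNReal.ofReal_mul (Real.exp_pos _).le, ← Real.exp_add,
      ← ENNReal.ofReal_mul (Real.exp_pos _).le, ← Real.exp_add, ← add_assoc] at hle
    rw [confidenceIntervals_eq_threeStage, confidenceIntervals_eq_threeStage]
    exact hle
  · have haq : a.HolderConjugate a.conjExponent := Real.HolderConjugate.conjExponent ha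
    have := hmech mode D
    have := hmech mode D'
    refine MomentDom.renyiDiv_le haq ?_
    rw [confidenceIntervals_eq_threeStage, confidenceIntervals_eq_threeStage]
    refine (momentDom_threeStage haq (hmH mode D) (hpH mode D) (hmH mode D') (hpH mode D')
      (hmC mode D) (hpC mode D) (hmC mode D') (hpC mode D') hpm hpp
      (momentDom_objPerturb hf hf' hm hφ₁ hf1 hf2 hn hc0 hε hD haq)
      (fun θ => momentDom_privSPDMat mode hφ₂ c
        (norm_toVec_sub_le_of_l2Sensitivity_le (hH θ) hD) haq)
      (fun θ => momentDom_privSPDMat mode hφ₃ c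
        (norm_toVec_sub_le_of_l2Sensitivity_le (hC θ) hD) haq)).mono (le_of_eq ?_)
    rw [← ENNReal.ofReal_mul (Real.exp_pos _).le, ← Real.exp_add,
      ← ENNReal.ofReal_mul (Real.exp_pos _).le, ← Real.exp_add]
    congr 2
    ring
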